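/- \textbf{Setting.} Let $\Theta$ be a measurable space and let $\xi=(\xi_n)_{n\ge 0}$ be a sequence of i.i.d. $\Theta$-valued random variables with law $\tau$ on $\Theta^{\mathbb N}$. Let $\eta$ be a probability kernel from $\Theta$ to $\mathbb N\times\mathbb R\times\mathbb R\times\cdots$, where $\mathbb N=\{0,1,2,\dots\}$. Given $\xi$, let $X(u)=(N(u),L_1(u),L_2(u),\dots)$, indexed by the finite sequences $u$ of labels (the empty sequence $\emptyset$ included), be independent random vectors such that $X(u)$ has law $\eta(\xi_n)$ when $u$ has length $|u|=n$. Their law given $\xi$ is the quenched law $\mathbb P_\xi$, with expectation $\mathbb E_\xi$; the joint law of $\xi$ and $(X(u))_u$ is the annealed law $\mathbb P$, with expectation $\mathbb E$. The branching random walk starts with one particle $\emptyset$ at $S_\emptyset=0$; each particle $u$ of generation $n$ is replaced by the $N(u)$ particles $ui$, $1\le i\le N(u)$, of generation $n+1$, located at $S_{ui}=S_u+L_i(u)$. Let $\mathbb T_n$ be the set of particles of generation $n$. For $t\in\mathbb R$ put $$m_n(t)=\mathbb E_\xi\sum_{i=1}^{N(u)}e^{tL_i(u)}\in[0,\infty]\quad(|u|=n),\qquad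 P_n(t)=\prod_{i=0}^{n-1}m_i(t),\qquad W_n=\frac1{P_n(1)}\sum_{u\in\mathbb T_n}e^{S_u}.$$ \textbf{Theorem (Annealed $L^p$ convergence).} Assume that $m_0(1)=1$ almost surely and that $\mathbb P(W_1=1)<1$, and let $p>1$. Then $W_n$ converges $\mathbb P$-almost surely to a finite limit $W$, and $W_n\to W$ in $L^p(\mathbb P)$ (that is, $W$ and all $W_n$ belong to $L^p(\mathbb P)$ and $\mathbb E|W_n-W|^p\to0$) if and only if $$\mathbb E\,W_1^p<\infty\qquad\text{and}\qquad \mathbb E\,m_0(p)<1 .$$ -/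

import Mathlib

open MeasureTheory ProbabilityTheory Filter Topology
open scoped ENNReal

namespace BRWRE

/-- The state space of the reproduction vectors `(N, L₁, L₂, …)`. For `x : Mark` the number of
children is `x.1`, and `x.2 i` is the displacement of the `(i+1)`-st child, so that children carry
the labels `0, …, N - 1`. -/
abbrev Mark : Type := ℕ × (ℕ → ℝ)

/-- Realizations of the family `(X(u))` of reproduction vectors, indexed by all finite
sequences `u` (Ulam–Harris labels); the generation of `u` is `u.length`. -/
abbrev Marks : Type := List ℕ → Mark

variable {Θ : Type*} [MeasurableSpace Θ]

/-- The quenched law given the environment `ξ`: the vectors `X(u)` are independent, and `X(u)` has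
law `η (ξ n)` for `u` of length `n`. -/
noncomputable def quenchedMeasure (η : Kernel Θ Mark) [IsMarkovKernel η] (ξ : ℕ → Θ) :
    Measure Marks :=
  Measure.infinitePi fun u : List ℕ => η (ξ u.length)

theorem measurable_quenchedMeasure (η : Kernel Θ Mark) [IsMarkovKernel η] :
    Measurable (quenchedMeasure η) := by
  have hprob : ∀ ξ, IsProbabilityMeasure (quenchedMeasure η ξ) := fun ξ => by
    unfold quenchedMeasure; infer_instance
  refine Measurable.measure_of_isPiSystem_of_isProbabilityMeasure
    (S := squareCylinders fun _ : List ℕ => {s : Set Mark | MeasurableSet s})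
    generateFrom_squareCylinders.symm
    (isPiSystem_squareCylinders (fun _ => MeasurableSpace.isPiSystem_measurableSet) (by simp)) ?_
  rintro S ⟨s, t, ht, rfl⟩
  have ht' : ∀ u, MeasurableSet (t u) := fun u => ht u (Set.mem_univ u)
  have h : (fun ξ => quenchedMeasure η ξ ((s : Set (List ℕ)).pi t))
      = fun ξ : ℕ → Θ => ∏ u ∈ s, η (ξ u.length) (t u) := by
    funext ξ
    exact Measure.infinitePi_pi _ fun u _ => ht' u
  rw [h]
  exact Finset.measurable_prod s fun u _ =>
    (η.measurable_coe (ht' u)).comp (measurable_pi_apply _)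

/-- The quenched laws as a Markov kernel from environments to families of reproduction vectors. -/
noncomputable def quenched (η : Kernel Θ Mark) [IsMarkovKernel η] : Kernel (ℕ → Θ) Marks where
  toFun := quenchedMeasure η
  measurable' := measurable_quenchedMeasure η

instance (η : Kernel Θ Mark) [IsMarkovKernel η] : IsMarkovKernel (quenched η) :=
  ⟨fun ξ => by
    change IsProbabilityMeasure (Measure.infinitePi fun u : List ℕ => η (ξ u.length))
    infer_instance⟩

/-- The annealed law: the environment `ξ` has law `τ`, and given `ξ` the reproduction vectors
follow the quenched law. -/
noncomputable def annealed (τ : Measure (ℕ → Θ)) (η : Kernel Θ Mark) [IsMarkovKernel η] :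
    Measure ((ℕ → Θ) × Marks) :=
  τ ⊗ₘ quenched η

/-- The set of particles of generation `n`: the root `[]` is the particle of generation `0`, and
the children of `u` are `u ++ [i]` for `i < N(u)`. -/
def generation (x : Marks) : ℕ → Finset (List ℕ)
  | 0 => {[]}
  | n + 1 => (generation x n).biUnion fun u =>
      (Finset.range (x u).1).image fun i => u ++ [i]

/-- The position `S_u` of `u = u₁ ⋯ u_n`: the sum of the displacements of `u₁ ⋯ u_{k+1}` relative
to `u₁ ⋯ u_k`, over `k < n`. -/
def position (x : Marks) (u : List ℕ) : ℝ :=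
  ∑ k ∈ Finset.range u.length, (x (u.take k)).2 (u.getD k 0)

/-- `∑_{|u| = n} exp (t S_u)`, the Laplace transform of the counting measure of
generation `n`. -/
noncomputable def partitionFn (t : ℝ) (n : ℕ) (x : Marks) : ℝ :=
  ∑ u ∈ generation x n, Real.exp (t * position x u)

/-- `m_n(t) = 𝔼_ξ ∑_{i ≤ N} exp (t L_i)`, where `(N, L₁, L₂, …)` has law `η (ξ n)`; possibly
infinite. -/
noncomputable def m (η : Kernel Θ Mark) (n : ℕ) (t : ℝ) (ξ : ℕ → Θ) : ℝ≥0∞ :=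
  ∫⁻ y, ∑ i ∈ Finset.range y.1, ENNReal.ofReal (Real.exp (t * y.2 i)) ∂(η (ξ n))

/-- `P_n(t) = m_0(t) ⋯ m_{n-1}(t)`. -/
noncomputable def P (η : Kernel Θ Mark) (n : ℕ) (t : ℝ) (ξ : ℕ → Θ) : ℝ≥0∞ :=
  ∏ i ∈ Finset.range n, m η i t ξ

/-- `W_n(t) = P_n(t)⁻¹ ∑_{|u| = n} exp (t S_u)`, where `P_n(t)` is to be positive and finite. -/
noncomputable def Wt (η : Kernel Θ Mark) (t : ℝ) (n : ℕ) (ω : (ℕ → Θ) × Marks) : ℝ :=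
  partitionFn t n ω.2 / (P η n t ω.1).toReal

/-- `W_n = W_n(1)`. -/
noncomputable def W (η : Kernel Θ Mark) (n : ℕ) (ω : (ℕ → Θ) × Marks) : ℝ :=
  Wt η 1 n ω

/-- The pointwise limit `W` of `W_n` as `n → ∞` (an arbitrary number where there is no limit). -/
noncomputable def Wlim (η : Kernel Θ Mark) (ω : (ℕ → Θ) × Marks) : ℝ :=
  limUnder atTop fun n => W η n ω

/-- Convergence of `f n` to `g` in `L^p`: all of them lie in `L^p` and `‖f n - g‖_p → 0`. -/
def ConvergesInLp {Ω : Type*} [MeasurableSpace Ω] (μ : Measure Ω) (p : ℝ)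
    (f : ℕ → Ω → ℝ) (g : Ω → ℝ) : Prop :=
  (∀ n, MemLp (f n) (ENNReal.ofReal p) μ) ∧ MemLp g (ENNReal.ofReal p) μ ∧
    Tendsto (fun n => eLpNorm (fun ω => f n ω - g ω) (ENNReal.ofReal p) μ) atTop (𝓝 0)

end BRWRE

/-!
Everything rests on splitting the population at the children of the root: `W_{n+1}` is the sum of
`exp (L_i) W_n^{(i)}` over these children, where the `W_n^{(i)}` are independent copies of `W_n` in
the shifted environment. Write `b = 𝔼 m_0(p)` and `α_n = 𝔼 W_n^p`.

If `b < 1`, bound `(x + y)^(p - 1) ≤ r x^(p - 1) + C y^(p - 1)` with `r > 1` and `r b < 1`, where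
`x` is the contribution of one child and `y` that of its siblings. The diagonal terms give
`r b α_n`. In the cross terms the two factors are independent and `W_n` has quenched mean one, so
truncating at a high level `K` bounds them by a constant plus a small multiple of `α_n`. Hence `α`
is bounded.

Conversely `(x + y)^p ≥ x^p + y^p + (2^(p - 1) - 1) (min x y)^p` gives `α_{n+1} ≥ b α_n`, with an
additional gain when the root has two children. If `α` is bounded then `W_n` does not concentrate
near zero, so the gain stays away from zero, which contradicts `b ≥ 1` unless the root almost surely
has at most one child. In that case boundedness leaves only `𝔼 W_1^p = b = 1 = (𝔼 W_1)^p`, which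
forces `W_1 = 1`.

Finally, `W_n` is a martingale for the filtration that contains the whole environment, and a
martingale converges in `L^p`, `p > 1`, exactly when it is bounded there.
-/

namespace BRWRE

section Inequalities

variable {ι : Type*} {p : ℝ}

theorem rpow_eq_mul_rpow_sub_one (hp : 1 ≤ p) (x : ℝ≥0∞) : x ^ p = x * x ^ (p - 1) := by
  conv_lhs => rw [← add_sub_cancel 1 p,
    ENNReal.rpow_add_of_nonneg _ _ zero_le_one (sub_nonneg.2 hp), ENNReal.rpow_one]

theorem exists_add_rpow_le {q : ℝ} (hq : 0 < q) {r : ℝ≥0∞} (hr : 1 < r) (hr' : r ≠ ∞) :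
    ∃ C ≠ ∞, ∀ x y : ℝ≥0∞, (x + y) ^ q ≤ r * x ^ q + C * y ^ q := by
  obtain ⟨s, hs1, hsr⟩ : ∃ s > 1, s ^ q = r :=
    ⟨r ^ q⁻¹, ENNReal.one_lt_rpow hr (inv_pos.2 hq), ENNReal.rpow_inv_rpow hq.ne' r⟩
  have hs : s ≠ ∞ := by
    rintro rfl
    exact hr' (hsr ▸ ENNReal.top_rpow_of_pos hq)
  obtain ⟨t, rfl⟩ := exists_add_of_le hs1.le
  have ht0 : t ≠ 0 := by rintro rfl; simp at hs1
  have htt : t ≠ ∞ := by rintro rfl; simp at hs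
  refine ⟨(1 + t⁻¹) ^ q, ENNReal.rpow_ne_top_of_nonneg hq.le (by simp [ht0]), fun x y => ?_⟩
  rcases le_total y (t * x) with h | h
  · calc (x + y) ^ q ≤ ((1 + t) * x) ^ q := by rw [add_mul, one_mul]; gcongr
      _ = r * x ^ q := by rw [ENNReal.mul_rpow_of_nonneg _ _ hq.le, hsr]
      _ ≤ _ := le_self_add
  · have hx : x ≤ t⁻¹ * y := by
      rw [← ENNReal.inv_mul_cancel_left ht0 htt (b := x)]
      gcongr
    calc (x + y) ^ q ≤ ((1 + t⁻¹) * y) ^ q := by rw [add_mul, one_mul, add_comm]; gcongr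
      _ = (1 + t⁻¹) ^ q * y ^ q := ENNReal.mul_rpow_of_nonneg _ _ hq.le
      _ ≤ _ := le_add_self

theorem rpow_sub_one_le (hp : 1 < p) (M y : ℝ≥0∞) :
    y ^ (p - 1) ≤ M ^ (p - 1) + M⁻¹ * y ^ p := by
  rcases le_total y M with h | h
  · exact (ENNReal.rpow_le_rpow h (by linarith)).trans le_self_add
  rcases eq_or_ne y 0 with rfl | hy
  · simp [ENNReal.zero_rpow_of_pos (sub_pos.2 hp)]
  rcases eq_or_ne M ∞ with rfl | hM
  · simp [ENNReal.top_rpow_of_pos (sub_pos.2 hp)]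
  refine le_trans ?_ le_add_self
  rcases eq_or_ne y ∞ with rfl | hy'
  · simp [ENNReal.top_rpow_of_pos (zero_lt_one.trans hp), ENNReal.mul_top, hM]
  · calc y ^ (p - 1) = y⁻¹ * y ^ p := by
          rw [rpow_eq_mul_rpow_sub_one hp.le, ENNReal.inv_mul_cancel_left hy hy']
      _ ≤ M⁻¹ * y ^ p := by gcongr

theorem sum_rpow_le_rpow_sum (hp : 1 ≤ p) (s : Finset ι) (x : ι → ℝ≥0∞) :
    ∑ i ∈ s, x i ^ p ≤ (∑ i ∈ s, x i) ^ p := by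
  classical
  induction s using Finset.induction_on with
  | empty => simp
  | insert a s ha ih =>
    rw [Finset.sum_insert ha, Finset.sum_insert ha]
    exact (add_le_add le_rfl ih).trans (ENNReal.add_rpow_le_rpow_add _ _ hp)

theorem rpow_sum_le [DecidableEq ι] (hp : 1 ≤ p) {r C : ℝ≥0∞}
    (hC : ∀ x y : ℝ≥0∞, (x + y) ^ (p - 1) ≤ r * x ^ (p - 1) + C * y ^ (p - 1))
    (s : Finset ι) (x : ι → ℝ≥0∞) :
    (∑ i ∈ s, x i) ^ p ≤
      r * ∑ i ∈ s, x i ^ p + C * ∑ i ∈ s, x i * (∑ j ∈ s.erase i, x j) ^ (p - 1) := by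
  rw [rpow_eq_mul_rpow_sub_one hp, Finset.sum_mul, Finset.mul_sum, Finset.mul_sum,
    ← Finset.sum_add_distrib]
  refine Finset.sum_le_sum fun i hi => ?_
  calc x i * (∑ j ∈ s, x j) ^ (p - 1)
      ≤ x i * (r * x i ^ (p - 1) + C * (∑ j ∈ s.erase i, x j) ^ (p - 1)) := by
        rw [← Finset.add_sum_erase s x hi]; gcongr; exact hC _ _
    _ = _ := by rw [rpow_eq_mul_rpow_sub_one hp (x i)]; ring

theorem rpow_sum_mul_le (hp : 1 ≤ p) (s : Finset ι) (a w : ι → ℝ≥0∞) :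
    (∑ i ∈ s, a i * w i) ^ p ≤ (∑ i ∈ s, a i) ^ (p - 1) * ∑ i ∈ s, a i * w i ^ p := by
  have hp0 : 0 < p := by linarith
  calc (∑ i ∈ s, a i * w i) ^ p
      ≤ ((∑ i ∈ s, a i) ^ (1 - p⁻¹) * (∑ i ∈ s, a i * w i ^ p) ^ p⁻¹) ^ p := by
        gcongr; exact ENNReal.inner_le_weight_mul_Lp_of_nonneg s hp a w
    _ = _ := by
        rw [ENNReal.mul_rpow_of_nonneg _ _ hp0.le, ← ENNReal.rpow_mul,
          ENNReal.rpow_inv_rpow hp0.ne', sub_mul, one_mul, inv_mul_cancel₀ hp0.ne']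

theorem add_rpow_add_min_rpow_le (hp : 1 ≤ p) (x y : ℝ≥0∞) :
    x ^ p + y ^ p + (2 ^ (p - 1) - 1) * min x y ^ p ≤ (x + y) ^ p := by
  wlog hxy : x ≤ y generalizing x y
  · simpa only [add_comm, min_comm] using this y x (le_of_not_ge hxy)
  have hp1 : 0 ≤ p - 1 := sub_nonneg.2 hp
  have h2 : (1 : ℝ≥0∞) ≤ 2 ^ (p - 1) := by
    simpa using ENNReal.rpow_le_rpow (one_le_two (α := ℝ≥0∞)) hp1
  calc x ^ p + y ^ p + (2 ^ (p - 1) - 1) * min x y ^ p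
      = (1 + (2 ^ (p - 1) - 1)) * x ^ p + y ^ p := by rw [min_eq_left hxy]; ring
    _ = x * (2 * x) ^ (p - 1) + y * y ^ (p - 1) := by
        rw [add_tsub_cancel_of_le h2, ENNReal.mul_rpow_of_nonneg _ _ hp1,
          rpow_eq_mul_rpow_sub_one hp x, rpow_eq_mul_rpow_sub_one hp y]
        ring
    _ ≤ x * (x + y) ^ (p - 1) + y * (x + y) ^ (p - 1) := by
        gcongr
        · rw [two_mul]; gcongr
        · exact le_add_self
    _ = (x + y) ^ p := by rw [rpow_eq_mul_rpow_sub_one hp (x + y)]; ring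

theorem sum_rpow_add_min_rpow_le (hp : 1 ≤ p) {s : Finset ι} {i j : ι} (hi : i ∈ s) (hj : j ∈ s)
    (hij : i ≠ j) (x : ι → ℝ≥0∞) :
    ∑ k ∈ s, x k ^ p + (2 ^ (p - 1) - 1) * min (x i) (x j) ^ p ≤ (∑ k ∈ s, x k) ^ p := by
  classical
  have hj' : j ∈ s.erase i := Finset.mem_erase.2 ⟨hij.symm, hj⟩
  simp only [← Finset.add_sum_erase s _ hi, ← Finset.add_sum_erase (s.erase i) _ hj', ← add_assoc]
  rw [add_right_comm]
  exact (add_le_add (add_rpow_add_min_rpow_le hp _ _) (sum_rpow_le_rpow_sum hp _ _)).trans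
    (ENNReal.add_rpow_le_rpow_add _ _ hp)

end Inequalities

section Moments

variable {Ω : Type*} [MeasurableSpace Ω] {μ : Measure Ω} {ι : Type*} {w : ι → Ω → ℝ≥0∞} {p : ℝ}

theorem lintegral_mul_rpow_sum_le (hp : 1 < p) {X : Ω → ℝ≥0∞} (hX : Measurable X)
    (hw : ∀ i, Measurable (w i)) (hXmean : ∫⁻ ω, X ω ∂μ ≤ 1) {α : ℝ≥0∞}
    (hα : ∀ i, ∫⁻ ω, w i ω ^ p ∂μ ≤ α) {s : Finset ι} (hind : ∀ i ∈ s, IndepFun X (w i) μ)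
    (a : ι → ℝ≥0∞) (K : ℝ≥0∞) :
    ∫⁻ ω, X ω * (∑ i ∈ s, a i * w i ω) ^ (p - 1) ∂μ ≤
      (∑ i ∈ s, a i) ^ (p - 1) * (K ^ (p - 1) + K⁻¹ * α) := by
  set A := ∑ i ∈ s, a i
  have hprod : ∀ i ∈ s, ∫⁻ ω, X ω * w i ω ^ p ∂μ ≤ α := fun i hi => by
    rw [show ∫⁻ ω, X ω * w i ω ^ p ∂μ = (∫⁻ ω, X ω ∂μ) * ∫⁻ ω, w i ω ^ p ∂μ from
      lintegral_mul_eq_lintegral_mul_lintegral_of_indepFun hX ((hw i).pow_const p)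
        ((hind i hi).comp measurable_id (measurable_id.pow_const p))]
    exact (mul_le_mul' hXmean (hα i)).trans_eq (one_mul α)
  have hK : (A * K)⁻¹ * A ≤ K⁻¹ := by
    rw [ENNReal.le_inv_iff_mul_le, mul_assoc]
    exact ENNReal.inv_mul_le_one _
  calc ∫⁻ ω, X ω * (∑ i ∈ s, a i * w i ω) ^ (p - 1) ∂μ
      ≤ ∫⁻ ω, (A * K) ^ (p - 1) * X ω
          + ∑ i ∈ s, (A * K)⁻¹ * A ^ (p - 1) * a i * (X ω * w i ω ^ p) ∂μ := by
        refine lintegral_mono fun ω => ?_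
        calc X ω * (∑ i ∈ s, a i * w i ω) ^ (p - 1)
            ≤ X ω * ((A * K) ^ (p - 1)
                + (A * K)⁻¹ * (A ^ (p - 1) * ∑ i ∈ s, a i * w i ω ^ p)) := by
              gcongr
              refine (rpow_sub_one_le hp (A * K) _).trans ?_
              gcongr
              exact rpow_sum_mul_le hp.le s a fun i => w i ω
          _ = _ := by
              rw [mul_add, mul_comm (X ω) ((A * K) ^ (p - 1)), ← mul_assoc (A * K)⁻¹,
                mul_left_comm, Finset.mul_sum, Finset.mul_sum]
              exact congrArg _ (Finset.sum_congr rfl fun i _ => by ring)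
    _ = (A * K) ^ (p - 1) * ∫⁻ ω, X ω ∂μ
          + ∑ i ∈ s, (A * K)⁻¹ * A ^ (p - 1) * a i * ∫⁻ ω, X ω * w i ω ^ p ∂μ := by
        rw [lintegral_add_left (by fun_prop), lintegral_const_mul _ hX,
          lintegral_finsetSum _ fun i _ => by fun_prop]
        congr! 2 with i _
        exact lintegral_const_mul _ (by fun_prop)
    _ ≤ (A * K) ^ (p - 1) * 1 + ∑ i ∈ s, (A * K)⁻¹ * A ^ (p - 1) * a i * α := by
        gcongr with i hi; exact hprod i hi
    _ = A ^ (p - 1) * (K ^ (p - 1) + (A * K)⁻¹ * A * α) := by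
        rw [← Finset.sum_mul, ← Finset.mul_sum, ENNReal.mul_rpow_of_nonneg _ _ (by linarith)]
        ring
    _ ≤ _ := by gcongr

theorem lintegral_rpow_sum_mul_le (hp : 1 < p) {r C : ℝ≥0∞}
    (hC : ∀ x y : ℝ≥0∞, (x + y) ^ (p - 1) ≤ r * x ^ (p - 1) + C * y ^ (p - 1))
    (hw : ∀ i, Measurable (w i)) (hind : Pairwise fun i j => IndepFun (w i) (w j) μ)
    (hmean : ∀ i, ∫⁻ ω, w i ω ∂μ ≤ 1) {α : ℝ≥0∞} (hα : ∀ i, ∫⁻ ω, w i ω ^ p ∂μ ≤ α)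
    (s : Finset ι) (a : ι → ℝ≥0∞) (K : ℝ≥0∞) :
    ∫⁻ ω, (∑ i ∈ s, a i * w i ω) ^ p ∂μ ≤
      r * ((∑ i ∈ s, a i ^ p) * α) + C * ((∑ i ∈ s, a i) ^ p * (K ^ (p - 1) + K⁻¹ * α)) := by
  classical
  have hp0 : 0 ≤ p := by linarith
  have : 0 ≤ p - 1 := by linarith
  have hcross : ∀ i ∈ s, ∫⁻ ω, w i ω * (∑ j ∈ s.erase i, a j * w j ω) ^ (p - 1) ∂μ ≤
      (∑ j ∈ s, a j) ^ (p - 1) * (K ^ (p - 1) + K⁻¹ * α) := fun i _ => by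
    refine (lintegral_mul_rpow_sum_le hp (hw i) hw (hmean i) hα
      (fun j hj => hind (Finset.ne_of_mem_erase hj).symm) a K).trans ?_
    gcongr
    exact Finset.erase_subset i s
  calc ∫⁻ ω, (∑ i ∈ s, a i * w i ω) ^ p ∂μ
      ≤ ∫⁻ ω, r * ∑ i ∈ s, a i ^ p * w i ω ^ p
          + C * ∑ i ∈ s, a i * (w i ω * (∑ j ∈ s.erase i, a j * w j ω) ^ (p - 1)) ∂μ := by
        refine lintegral_mono fun ω => (rpow_sum_le hp.le hC s fun i => a i * w i ω).trans_eq ?_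
        simp only [ENNReal.mul_rpow_of_nonneg _ _ hp0, mul_assoc]
    _ = r * ∑ i ∈ s, a i ^ p * ∫⁻ ω, w i ω ^ p ∂μ
          + C * ∑ i ∈ s, a i * ∫⁻ ω, w i ω * (∑ j ∈ s.erase i, a j * w j ω) ^ (p - 1) ∂μ := by
        rw [lintegral_add_left (by fun_prop), lintegral_const_mul _ (by fun_prop),
          lintegral_const_mul _ (by fun_prop), lintegral_finsetSum _ fun i _ => by fun_prop,
          lintegral_finsetSum _ fun i _ => by fun_prop]
        congr! 4 with i _ i _ <;> exact lintegral_const_mul _ (by fun_prop)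
    _ ≤ r * ∑ i ∈ s, a i ^ p * α
          + C * ∑ i ∈ s, a i * ((∑ j ∈ s, a j) ^ (p - 1) * (K ^ (p - 1) + K⁻¹ * α)) := by
        gcongr with i _ i hi
        · exact hα i
        · exact hcross i hi
    _ = _ := by
        rw [← Finset.sum_mul, ← Finset.sum_mul, ← mul_assoc (∑ i ∈ s, a i),
          ← rpow_eq_mul_rpow_sub_one hp.le]

end Moments

section Jensen

variable {Ω : Type*} [MeasurableSpace Ω] {μ : Measure Ω} [IsProbabilityMeasure μ] {f : Ω → ℝ≥0∞}
  {p : ℝ}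

theorem rpow_lintegral_le_lintegral_rpow (hp : 1 ≤ p) (hf : Measurable f) :
    (∫⁻ ω, f ω ∂μ) ^ p ≤ ∫⁻ ω, f ω ^ p ∂μ := by
  have h := eLpNorm'_le_eLpNorm'_of_exponent_le zero_lt_one hp μ hf.aestronglyMeasurable
  simp only [eLpNorm', enorm_eq_self, ENNReal.rpow_one, div_one, one_div] at h
  exact (ENNReal.le_rpow_inv_iff (by linarith)).1 h

theorem lintegral_le_add_rpow_mul_measure_rpow {q : ℝ} (hpq : p.HolderConjugate q)
    (hf : Measurable f) (s : ℝ≥0∞) :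
    ∫⁻ ω, f ω ∂μ ≤ s + (∫⁻ ω, f ω ^ p ∂μ) ^ (1 / p) * μ {ω | s ≤ f ω} ^ (1 / q) := by
  set S := {ω | s ≤ f ω}
  have hS : MeasurableSet S := measurableSet_le measurable_const hf
  have hholder : ∫⁻ ω, f ω * S.indicator 1 ω ∂μ ≤
      (∫⁻ ω, f ω ^ p ∂μ) ^ (1 / p) * μ S ^ (1 / q) := by
    have hpow : ∀ ω, S.indicator (1 : Ω → ℝ≥0∞) ω ^ q = S.indicator 1 ω := fun ω => by
      by_cases hω : ω ∈ S <;> simp [hω, ENNReal.zero_rpow_of_pos hpq.symm.pos]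
    have h := ENNReal.lintegral_mul_le_Lp_mul_Lq μ hpq hf.aemeasurable
      (measurable_one.indicator hS).aemeasurable
    rwa [lintegral_congr hpow, lintegral_indicator_one hS] at h
  calc ∫⁻ ω, f ω ∂μ ≤ ∫⁻ ω, s + f ω * S.indicator 1 ω ∂μ := by
        refine lintegral_mono fun ω => ?_
        by_cases hω : ω ∈ S
        · simp [hω]
        · simpa [hω] using (not_le.1 hω).le
    _ = s + ∫⁻ ω, f ω * S.indicator 1 ω ∂μ := by
        rw [lintegral_add_left measurable_const, lintegral_const, measure_univ, mul_one]
    _ ≤ _ := by gcongr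

theorem exists_ne_zero_le_measure_half_le (hp : 1 < p) {R : ℝ≥0∞} (hR : R ≠ ∞) :
    ∃ δ ≠ 0, ∀ {f : Ω → ℝ≥0∞}, Measurable f → ∫⁻ ω, f ω ∂μ = 1 → ∫⁻ ω, f ω ^ p ∂μ ≤ R →
      δ ≤ μ {ω | 2⁻¹ ≤ f ω} := by
  obtain ⟨q, hpq⟩ : ∃ q, p.HolderConjugate q := ⟨_, .conjExponent hp⟩
  refine ⟨(2⁻¹ / R ^ (1 / p)) ^ q, ?_, fun {f} hf hone hfR => ?_⟩
  · simp [ENNReal.rpow_eq_zero_iff, ENNReal.div_eq_zero_iff, hR, hpq.symm.nonneg, hpq.nonneg.not_gt]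
  · have h := (lintegral_le_add_rpow_mul_measure_rpow hpq hf 2⁻¹).trans
      (add_le_add_right (mul_le_mul_left (ENNReal.rpow_le_rpow hfR (by positivity)) _) _)
    rw [hone, ← tsub_le_iff_left, ENNReal.one_sub_inv_two, one_div q] at h
    exact (ENNReal.le_rpow_inv_iff hpq.symm.pos).1 (ENNReal.div_le_of_le_mul' h)

theorem ae_eq_one_of_lintegral_rpow_le_one (hp : 1 < p) (hf : Measurable f)
    (hmean : ∫⁻ ω, f ω ∂μ = 1) (hpow : ∫⁻ ω, f ω ^ p ∂μ ≤ 1) : ∀ᵐ ω ∂μ, f ω = 1 := by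
  have hp0 : 0 ≤ p := by linarith
  have hfin : ∀ᵐ ω ∂μ, f ω < ∞ := ae_lt_top hf (by simp [hmean])
  have hfi : Integrable (fun ω => (f ω).toReal) μ :=
    integrable_toReal_of_lintegral_ne_top hf.aemeasurable (by simp [hmean])
  have hgi : Integrable (fun ω => (f ω ^ p).toReal) μ :=
    integrable_toReal_of_lintegral_ne_top (by fun_prop) (hpow.trans_lt ENNReal.one_lt_top).ne
  have hmeanReal : ∫ ω, (f ω).toReal ∂μ = 1 := by
    rw [integral_toReal hf.aemeasurable hfin, hmean, ENNReal.toReal_one]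
  have hpowReal : ∫ ω, (f ω ^ p).toReal ∂μ ≤ 1 := by
    rw [integral_toReal (by fun_prop)
      (hfin.mono fun ω hω => ENNReal.rpow_lt_top_of_nonneg hp0 hω.ne)]
    exact ENNReal.toReal_le_of_le_ofReal zero_le_one (by simpa using hpow)
  simp only [← ENNReal.toReal_rpow] at hgi hpowReal
  rcases (strictConvexOn_rpow hp).ae_eq_const_or_map_average_lt
    (continuousOn_id.rpow_const fun _ _ => .inr hp0) isClosed_Ici
    (ae_of_all μ fun ω => ENNReal.toReal_nonneg) hfi hgi with h | h
  · filter_upwards [h] with ω hω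
    rw [average_eq_integral, hmeanReal, Function.const_apply] at hω
    rwa [ENNReal.toReal_eq_one_iff] at hω
  · rw [average_eq_integral, average_eq_integral, hmeanReal, Real.one_rpow] at h
    exact absurd hpowReal h.not_ge

end Jensen

section Sequences

variable {u : ℕ → ℝ≥0∞} {b d : ℝ≥0∞}

theorem iSup_lt_top_of_le_mul_add (h0 : u 0 ≠ ∞) (hb : b < 1) (hd : d ≠ ∞)
    (h : ∀ n, u (n + 1) ≤ b * u n + d) : ⨆ n, u n < ∞ := by
  have hb0 : 1 - b ≠ 0 := (tsub_pos_of_lt hb).ne'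
  have hbt : 1 - b ≠ ∞ := ENNReal.sub_ne_top ENNReal.one_ne_top
  set R := u 0 + (1 - b)⁻¹ * d
  have hfix : b * ((1 - b)⁻¹ * d) + d = (1 - b)⁻¹ * d := by
    calc b * ((1 - b)⁻¹ * d) + d
        = (b + (1 - b)) * ((1 - b)⁻¹ * d) := by
          rw [add_mul, ENNReal.mul_inv_cancel_left hb0 hbt]
      _ = (1 - b)⁻¹ * d := by rw [add_tsub_cancel_of_le hb.le, one_mul]
  have hR : ∀ n, u n ≤ R := fun n => by
    induction n with
    | zero => exact le_self_add
    | succ n ih =>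
      calc u (n + 1) ≤ b * R + d := (h n).trans (by gcongr)
        _ = b * u 0 + (1 - b)⁻¹ * d := by rw [mul_add, add_assoc, hfix]
        _ ≤ 1 * u 0 + (1 - b)⁻¹ * d := by gcongr
        _ = R := by rw [one_mul]
  exact (iSup_le hR).trans_lt (by finiteness)

theorem eq_one_and_eq_zero_of_mul_add_le (h0 : u 0 = 1) (hu : ⨆ n, u n < ∞) (hb : 1 ≤ b)
    (h : ∀ n, b * u n + d ≤ u (n + 1)) : b = 1 ∧ d = 0 := by
  have hpow : ∀ n, b ^ n ≤ u n := fun n => by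
    induction n with
    | zero => simp [h0]
    | succ n ih =>
      calc b ^ (n + 1) = b * b ^ n := pow_succ' b n
        _ ≤ b * u n := by gcongr
        _ ≤ u (n + 1) := le_self_add.trans (h n)
  have hmul : ∀ n : ℕ, n * d ≤ u n := fun n => by
    induction n with
    | zero => simp
    | succ n ih =>
      calc ((n + 1 : ℕ) : ℝ≥0∞) * d = 1 * (n * d) + d := by push_cast; ring
        _ ≤ b * u n + d := by gcongr
        _ ≤ u (n + 1) := h n
  refine ⟨hb.antisymm' (not_lt.1 fun hlt => ?_), by_contra fun hd => ?_⟩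
  · exact hu.not_ge <| le_of_tendsto' (ENNReal.tendsto_pow_atTop_nhds_top_iff.2 hlt) fun n =>
      (hpow n).trans (le_iSup u n)
  · obtain ⟨n, hn⟩ := ENNReal.exists_nat_mul_gt hd hu.ne
    exact hn.not_ge ((hmul n).trans (le_iSup u n))

end Sequences

section Tree

/-- The reproduction vectors of the descendants of the particle `i` of the first generation,
labelled relative to `i`. -/
def subtree (x : Marks) (i : ℕ) : Marks := fun v => x (i :: v)

/-- `exp (L_i)` with values in `ℝ≥0∞`. -/
noncomputable def weight (y : Mark) (i : ℕ) : ℝ≥0∞ := ENNReal.ofReal (Real.exp (y.2 i))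

/-- `∑_{i ≤ N} exp (t L_i)`, the integrand in the definition of `m`. -/
noncomputable def childSum (t : ℝ) (y : Mark) : ℝ≥0∞ :=
  ∑ i ∈ Finset.range y.1, ENNReal.ofReal (Real.exp (t * y.2 i))

/-- `∑_{|u| = n} exp (S_u)` with values in `ℝ≥0∞`; this is `W_n` when `P_n(1) = 1`. -/
noncomputable def mass (n : ℕ) (x : Marks) : ℝ≥0∞ :=
  ∑ u ∈ generation x n, ENNReal.ofReal (Real.exp (position x u))

variable {x : Marks} {n : ℕ} {u : List ℕ}

theorem childSum_one (y : Mark) : childSum 1 y = ∑ i ∈ Finset.range y.1, weight y i := by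
  simp only [childSum, weight, one_mul]

theorem childSum_eq_sum_rpow (t : ℝ) (y : Mark) :
    childSum t y = ∑ i ∈ Finset.range y.1, weight y i ^ t :=
  Finset.sum_congr rfl fun i _ => by
    rw [weight, ENNReal.ofReal_rpow_of_pos (Real.exp_pos _), ← Real.exp_mul, mul_comm]

theorem mem_generation_succ :
    u ∈ generation x (n + 1) ↔ ∃ v ∈ generation x n, ∃ i < (x v).1, v ++ [i] = u := by
  simp [generation]

theorem append_singleton_mem_generation_succ {i : ℕ} :
    u ++ [i] ∈ generation x (n + 1) ↔ u ∈ generation x n ∧ i < (x u).1 := by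
  rw [mem_generation_succ]
  constructor
  · rintro ⟨v, hv, j, hj, h⟩
    obtain ⟨rfl, hij⟩ := List.append_inj' h rfl
    obtain rfl : j = i := by simpa using hij
    exact ⟨hv, hj⟩
  · rintro ⟨hu, hi⟩
    exact ⟨u, hu, i, hi, rfl⟩

theorem length_of_mem_generation (hu : u ∈ generation x n) : u.length = n := by
  induction n generalizing u with
  | zero => simp_all [generation]
  | succ n ih =>
    obtain ⟨v, hv, i, -, rfl⟩ := mem_generation_succ.1 hu
    simp [ih hv]

theorem mem_generation_succ_iff_root :
    u ∈ generation x (n + 1) ↔ ∃ i < (x []).1, ∃ v ∈ generation (subtree x i) n, i :: v = u := by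
  induction n generalizing u with
  | zero => simp [generation]
  | succ n ih =>
    rw [mem_generation_succ]
    constructor
    · rintro ⟨v, hv, j, hj, rfl⟩
      obtain ⟨i, hi, w, hw, rfl⟩ := ih.1 hv
      exact ⟨i, hi, w ++ [j], mem_generation_succ.2 ⟨w, hw, j, hj, rfl⟩, rfl⟩
    · rintro ⟨i, hi, v, hv, rfl⟩
      obtain ⟨w, hw, j, hj, rfl⟩ := mem_generation_succ.1 hv
      exact ⟨i :: w, ih.2 ⟨i, hi, w, hw, rfl⟩, j, hj, rfl⟩

theorem generation_succ_eq_biUnion_subtree (x : Marks) (n : ℕ) :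
    generation x (n + 1) = (Finset.range (x []).1).biUnion fun i =>
      (generation (subtree x i) n).image fun v => i :: v := by
  ext u
  simp [mem_generation_succ_iff_root]

theorem position_cons (x : Marks) (i : ℕ) (v : List ℕ) :
    position x (i :: v) = (x []).2 i + position (subtree x i) v := by
  simp [position, Finset.sum_range_succ', subtree, add_comm]

theorem position_append_singleton (x : Marks) (u : List ℕ) (i : ℕ) :
    position x (u ++ [i]) = position x u + (x u).2 i := by
  rw [position, List.length_append, List.length_singleton, Finset.sum_range_succ, position]
  congr 1
  · refine Finset.sum_congr rfl fun k hk => ?_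
    have hk' : k < u.length := Finset.mem_range.1 hk
    rw [List.take_append_of_le_length hk'.le, List.getD_append _ _ _ _ hk']
  · simp

theorem mass_zero (x : Marks) : mass 0 x = 1 := by
  simp [mass, generation, position]

theorem mass_succ (n : ℕ) (x : Marks) :
    mass (n + 1) x = ∑ i ∈ Finset.range (x []).1, weight (x []) i * mass n (subtree x i) := by
  rw [mass, generation_succ_eq_biUnion_subtree, Finset.sum_biUnion]
  · refine Finset.sum_congr rfl fun i _ => ?_
    rw [Finset.sum_image (by simp), mass, Finset.mul_sum]
    refine Finset.sum_congr rfl fun v _ => ?_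
    rw [position_cons, Real.exp_add, ENNReal.ofReal_mul (Real.exp_nonneg _), weight]
  · intro i _ j _ hij
    simp only [Function.onFun, Finset.disjoint_left, Finset.mem_image]
    rintro _ ⟨v, _, rfl⟩ ⟨w, _, h⟩
    exact hij (List.cons.inj h).1.symm

theorem mass_succ_eq_sum_generation (n : ℕ) (x : Marks) :
    mass (n + 1) x = ∑ u ∈ generation x n,
      ENNReal.ofReal (Real.exp (position x u)) * childSum 1 (x u) := by
  rw [mass, generation, Finset.sum_biUnion]
  · refine Finset.sum_congr rfl fun u _ => ?_
    rw [Finset.sum_image (by simp), childSum_one, Finset.mul_sum]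
    refine Finset.sum_congr rfl fun i _ => ?_
    rw [position_append_singleton, Real.exp_add, ENNReal.ofReal_mul (Real.exp_nonneg _), weight]
  · intro u _ v _ huv
    simp only [Function.onFun, Finset.disjoint_left, Finset.mem_image]
    rintro _ ⟨i, _, rfl⟩ ⟨j, _, h⟩
    exact huv (List.append_inj' h rfl).1.symm

theorem mass_one (x : Marks) : mass 1 x = childSum 1 (x []) := by
  simp [mass_succ, mass_zero, childSum_one]

theorem mass_ne_top (n : ℕ) (x : Marks) : mass n x ≠ ∞ :=
  ENNReal.sum_ne_top.2 fun _ _ => ENNReal.ofReal_ne_top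

theorem toReal_mass (n : ℕ) (x : Marks) : (mass n x).toReal = partitionFn 1 n x := by
  rw [mass, ENNReal.toReal_sum fun _ _ => ENNReal.ofReal_ne_top, partitionFn]
  exact Finset.sum_congr rfl fun u _ => by rw [one_mul, ENNReal.toReal_ofReal (Real.exp_nonneg _)]

end Tree

section Independence

variable {Ω ι β γ : Type*} {E : ι → Type*} [∀ i, MeasurableSpace (E i)] {X : ∀ i, Ω → E i}

theorem measurable_biSup_comap {S : Set ι} {i : ι} (hi : i ∈ S) :
    Measurable[⨆ i ∈ S, MeasurableSpace.comap (X i) inferInstance] (X i) :=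
  measurable_iff_comap_le.2 (le_iSup₂_of_le i hi le_rfl)

theorem indepFun_of_measurable_biSup_comap [MeasurableSpace Ω] [MeasurableSpace β]
    [MeasurableSpace γ] {μ : Measure Ω} (hX : ∀ i, Measurable (X i)) (hind : iIndepFun X μ)
    {S T : Set ι} (hST : Disjoint S T) {f : Ω → β} {g : Ω → γ}
    (hf : Measurable[⨆ i ∈ S, MeasurableSpace.comap (X i) inferInstance] f)
    (hg : Measurable[⨆ i ∈ T, MeasurableSpace.comap (X i) inferInstance] g) : IndepFun f g μ :=
  indep_of_indep_of_le_left (indep_of_indep_of_le_right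
    (indep_iSup_of_disjoint (fun i => (hX i).comap_le) hind hST) hg.comap_le) hf.comap_le

theorem rpow_mul_measure_mul_le_lintegral_min_rpow [MeasurableSpace Ω] {μ : Measure Ω}
    {f g : Ω → ℝ≥0∞} {p : ℝ} (hf : Measurable f) (hg : Measurable g)
    (hfg : IndepFun f g μ) (hp : 0 ≤ p) (s : ℝ≥0∞) :
    s ^ p * (μ {ω | s ≤ f ω} * μ {ω | s ≤ g ω}) ≤ ∫⁻ ω, min (f ω) (g ω) ^ p ∂μ := by
  have hinter : μ {ω | s ≤ min (f ω) (g ω)} = μ {ω | s ≤ f ω} * μ {ω | s ≤ g ω} := by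
    simp_rw [le_min_iff]
    exact hfg.measure_inter_preimage_eq_mul (Set.Ici s) (Set.Ici s) measurableSet_Ici
      measurableSet_Ici
  rw [← hinter]
  refine le_trans ?_ (mul_meas_ge_le_lintegral (by fun_prop) (s ^ p))
  exact mul_le_mul_right (measure_mono fun ω hω => ENNReal.rpow_le_rpow hω hp) _

end Independence

section Measurability

theorem measurable_sum_range_comp {α : Type*} [MeasurableSpace α] {N : α → ℕ} (hN : Measurable N)
    {g : ℕ → α → ℝ≥0∞} (hg : ∀ i, Measurable (g i)) :
    Measurable fun a => ∑ i ∈ Finset.range (N a), g i a := by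
  have h : Measurable fun q : ℕ × α => ∑ i ∈ Finset.range q.1, g i q.2 :=
    measurable_from_prod_countable_right fun n => by
      simpa using Finset.measurable_sum _ fun i _ => hg i
  exact h.comp (hN.prodMk measurable_id)

@[fun_prop]
theorem measurable_childSum (t : ℝ) : Measurable (childSum t) :=
  measurable_sum_range_comp (by fun_prop) fun i => by fun_prop

@[fun_prop]
theorem measurable_weight (i : ℕ) : Measurable fun y => weight y i := by
  unfold weight; fun_prop

@[fun_prop]
theorem measurable_subtree : Measurable subtree := by
  unfold subtree; fun_prop

/-- The σ-algebra generated by the reproduction vectors of the generations before `n`. -/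
@[reducible]
def history (n : ℕ) : MeasurableSpace Marks :=
  ⨆ v ∈ {v : List ℕ | v.length < n}, MeasurableSpace.comap (fun x : Marks => x v) inferInstance

theorem history_le (n : ℕ) : history n ≤ (inferInstance : MeasurableSpace Marks) :=
  iSup₂_le fun v _ => (measurable_pi_apply v).comap_le

theorem history_mono : Monotone history := fun _ _ h =>
  biSup_mono fun _ hv => lt_of_lt_of_le hv h

theorem measurable_history_eval {n : ℕ} {v : List ℕ} (hv : v.length < n) :
    Measurable[history n] fun x : Marks => x v :=
  measurable_biSup_comap (X := fun (v : List ℕ) (x : Marks) => x v) hv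

theorem measurableSet_mem_generation (u : List ℕ) :
    MeasurableSet[history u.length] {x | u ∈ generation x u.length} := by
  induction u using List.reverseRecOn with
  | nil => simp [generation]
  | append_singleton v i ih =>
    rw [List.length_append, List.length_singleton]
    simp only [append_singleton_mem_generation_succ]
    refine (history_mono v.length.le_succ _ ih).inter ?_
    have hlt : MeasurableSet {y : Mark | i < y.1} :=
      measurableSet_lt measurable_const measurable_fst
    exact measurable_history_eval v.length.lt_succ_self hlt

theorem measurable_position (u : List ℕ) :
    Measurable[history u.length] fun x : Marks => position x u := by
  refine @Finset.measurable_sum _ _ _ _ _ _ (history u.length) _ _ fun k hk => ?_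
  have hk' : k < u.length := Finset.mem_range.1 hk
  have hcoord : Measurable fun y : Mark => y.2 (u.getD k 0) := by fun_prop
  exact hcoord.comp (measurable_history_eval (by rw [List.length_take]; lia))

/-- `exp (S_u)` for a particle `u` of generation `n`, and `0` for every other label. -/
noncomputable def particleMass (n : ℕ) (u : List ℕ) (x : Marks) : ℝ≥0∞ :=
  if u ∈ generation x n then ENNReal.ofReal (Real.exp (position x u)) else 0

theorem particleMass_of_length_ne {n : ℕ} {u : List ℕ} (hu : u.length ≠ n) (x : Marks) :
    particleMass n u x = 0 :=
  if_neg fun h => hu (length_of_mem_generation h)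

theorem measurable_particleMass (n : ℕ) (u : List ℕ) :
    Measurable[history n] (particleMass n u) := by
  by_cases hu : u.length = n
  · subst hu
    refine Measurable.ite (measurableSet_mem_generation u) ?_ measurable_const
    exact (measurable_position u).exp.ennreal_ofReal
  · rw [funext (particleMass_of_length_ne hu)]
    exact measurable_const

theorem tsum_particleMass_mul (n : ℕ) (x : Marks) (f : List ℕ → ℝ≥0∞) :
    ∑' u, particleMass n u x * f u =
      ∑ u ∈ generation x n, ENNReal.ofReal (Real.exp (position x u)) * f u := by
  rw [tsum_eq_sum (s := generation x n) fun u hu => by rw [particleMass, if_neg hu, zero_mul]]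
  exact Finset.sum_congr rfl fun u hu => by rw [particleMass, if_pos hu]

theorem mass_eq_tsum (n : ℕ) (x : Marks) : mass n x = ∑' u, particleMass n u x := by
  simpa [mass] using (tsum_particleMass_mul n x fun _ => 1).symm

theorem mass_succ_eq_tsum (n : ℕ) (x : Marks) :
    mass (n + 1) x = ∑' u, particleMass n u x * childSum 1 (x u) := by
  rw [mass_succ_eq_sum_generation, tsum_particleMass_mul]

theorem measurable_history_mass (n : ℕ) : Measurable[history n] (mass n) := by
  rw [funext fun x => mass_eq_tsum n x]
  simp_rw [ENNReal.tsum_eq_iSup_sum]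
  exact .iSup fun s => s.measurable_fun_sum fun u _ => measurable_particleMass n u

@[fun_prop]
theorem measurable_mass (n : ℕ) : Measurable (mass n) :=
  (measurable_history_mass n).mono (history_le n) le_rfl

end Measurability

section Environment

variable {Θ : Type*} [MeasurableSpace Θ]

/-- The environment seen from the first generation on. -/
def shift (ξ : ℕ → Θ) : ℕ → Θ := fun n => ξ (n + 1)

@[fun_prop]
theorem measurable_shift : Measurable (shift : (ℕ → Θ) → ℕ → Θ) := by
  unfold shift; fun_prop

variable {τ : Measure (ℕ → Θ)}

theorem map_shift (h_indep : iIndepFun (fun (n : ℕ) (ξ : ℕ → Θ) => ξ n) τ)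
    (h_ident : ∀ n : ℕ, IdentDistrib (fun ξ : ℕ → Θ => ξ n) (fun ξ : ℕ → Θ => ξ 0) τ τ) :
    τ.map shift = τ := by
  have hprod : τ.map id = Measure.infinitePi fun n => τ.map fun ξ : ℕ → Θ => ξ n :=
    h_indep.map_fun_eq_infinitePi_map fun n => measurable_pi_apply n
  have hprodShift : τ.map shift = Measure.infinitePi fun n => τ.map fun ξ : ℕ → Θ => ξ (n + 1) :=
    (h_indep.precomp Nat.succ_injective).map_fun_eq_infinitePi_map
      fun n => measurable_pi_apply (n + 1)
  simp_rw [(h_ident _).map_eq] at hprod hprodShift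
  rw [hprodShift, ← hprod, Measure.map_id]

theorem measurePreserving_zero_shift [IsProbabilityMeasure τ]
    (h_indep : iIndepFun (fun (n : ℕ) (ξ : ℕ → Θ) => ξ n) τ)
    (h_ident : ∀ n : ℕ, IdentDistrib (fun ξ : ℕ → Θ => ξ n) (fun ξ : ℕ → Θ => ξ 0) τ τ) :
    MeasurePreserving (fun ξ : ℕ → Θ => (ξ 0, shift ξ)) τ ((τ.map fun ξ => ξ 0).prod τ) := by
  have hind : IndepFun (fun ξ : ℕ → Θ => ξ 0) shift τ :=
    indepFun_of_measurable_biSup_comap (fun n => measurable_pi_apply n) h_indep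
      (S := {0}) (T := {0}ᶜ) disjoint_compl_right
      (measurable_biSup_comap (X := fun (n : ℕ) (ξ : ℕ → Θ) => ξ n) (Set.mem_singleton _))
      (@measurable_pi_lambda _ _ _ (_) _ _ fun n =>
        measurable_biSup_comap (X := fun (n : ℕ) (ξ : ℕ → Θ) => ξ n) (Nat.succ_ne_zero n))
  refine ⟨by fun_prop, ?_⟩
  rw [(indepFun_iff_map_prod_eq_prod_map_map (measurable_pi_apply 0).aemeasurable
    measurable_shift.aemeasurable).1 hind, map_shift h_indep h_ident]

theorem lintegral_zero_mul_shift [SFinite τ]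
    (hτ : MeasurePreserving (fun ξ : ℕ → Θ => (ξ 0, shift ξ)) τ ((τ.map fun ξ => ξ 0).prod τ))
    {f : Θ → ℝ≥0∞} (hf : Measurable f) {g : (ℕ → Θ) → ℝ≥0∞} (hg : Measurable g) :
    ∫⁻ ξ, f (ξ 0) * g (shift ξ) ∂τ = (∫⁻ ξ, f (ξ 0) ∂τ) * ∫⁻ ξ, g ξ ∂τ := by
  rw [hτ.lintegral_comp (f := fun q => f q.1 * g q.2) (by fun_prop),
    lintegral_prod_mul hf.aemeasurable hg.aemeasurable, lintegral_map hf (by fun_prop)]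

variable {η : Kernel Θ Mark}

theorem measurable_lintegral_kernel_eval {f : Mark → ℝ≥0∞} (hf : Measurable f) (n : ℕ) :
    Measurable fun ξ : ℕ → Θ => ∫⁻ y, f y ∂(η (ξ n)) :=
  (hf.lintegral_kernel (κ := η)).comp (measurable_pi_apply n)

@[fun_prop]
theorem measurable_m (n : ℕ) (p : ℝ) : Measurable (m η n p) :=
  measurable_lintegral_kernel_eval (measurable_childSum p) n

theorem lintegral_lintegral_kernel_mul_shift [SFinite τ]
    (hτ : MeasurePreserving (fun ξ : ℕ → Θ => (ξ 0, shift ξ)) τ ((τ.map fun ξ => ξ 0).prod τ))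
    {f : Mark → ℝ≥0∞} (hf : Measurable f) {g : (ℕ → Θ) → ℝ≥0∞} (hg : Measurable g) :
    ∫⁻ ξ, (∫⁻ y, f y ∂(η (ξ 0))) * g (shift ξ) ∂τ =
      (∫⁻ ξ, ∫⁻ y, f y ∂(η (ξ 0)) ∂τ) * ∫⁻ ξ, g ξ ∂τ :=
  lintegral_zero_mul_shift hτ hf.lintegral_kernel hg

theorem ae_m_eq_one
    (h_ident : ∀ n : ℕ, IdentDistrib (fun ξ : ℕ → Θ => ξ n) (fun ξ : ℕ → Θ => ξ 0) τ τ)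
    (h_mean : ∀ᵐ ξ ∂τ, m η 0 1 ξ = 1) : ∀ᵐ ξ ∂τ, ∀ n, m η n 1 ξ = 1 :=
  ae_all_iff.2 fun n => (h_ident n).symm.ae_snd (p := fun θ => ∫⁻ y, childSum 1 y ∂(η θ) = 1)
    (measurableSet_eq_fun (measurable_childSum 1).lintegral_kernel measurable_const) h_mean

theorem P_eq_one {ξ : ℕ → Θ} (hξ : ∀ n, m η n 1 ξ = 1) (n : ℕ) : P η n 1 ξ = 1 :=
  Finset.prod_eq_one fun i _ => hξ i

end Environment

section Quenched

variable {Θ : Type*} [MeasurableSpace Θ] (η : Kernel Θ Mark) [IsMarkovKernel η] (ξ : ℕ → Θ)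

instance : IsProbabilityMeasure (quenchedMeasure η ξ) := by
  unfold quenchedMeasure; infer_instance

theorem iIndepFun_quenchedMeasure :
    iIndepFun (fun (u : List ℕ) (x : Marks) => x u) (quenchedMeasure η ξ) :=
  iIndepFun_infinitePi (X := fun _ y => y) fun _ => measurable_id

theorem measurePreserving_eval_quenchedMeasure (u : List ℕ) :
    MeasurePreserving (fun x : Marks => x u) (quenchedMeasure η ξ) (η (ξ u.length)) :=
  ⟨measurable_pi_apply u, Measure.infinitePi_map_eval _ u⟩

theorem map_subtree_quenchedMeasure :
    (quenchedMeasure η ξ).map subtree =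
      Measure.infinitePi fun _ : ℕ => quenchedMeasure η (shift ξ) := by
  have hinj : Function.Injective fun q : ℕ × List ℕ => q.1 :: q.2 := by
    rintro ⟨i, v⟩ ⟨j, w⟩ h
    simpa using h
  have hcurry : (subtree : Marks → ℕ → Marks) = (MeasurableEquiv.curry ℕ (List ℕ) Mark) ∘
      fun x (q : ℕ × List ℕ) => x (q.1 :: q.2) := rfl
  rw [hcurry, ← Measure.map_map (MeasurableEquiv.measurable _) (by fun_prop), quenchedMeasure,
    Measure.map_infinitePi_infinitePi_of_inj (P := fun u : List ℕ => η (ξ u.length)) hinj]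
  exact Measure.infinitePi_map_curry fun (_ : ℕ) (v : List ℕ) => η (shift ξ v.length)

theorem measurePreserving_root_subtree :
    MeasurePreserving (fun x : Marks => (x [], subtree x)) (quenchedMeasure η ξ)
      ((η (ξ 0)).prod (Measure.infinitePi fun _ : ℕ => quenchedMeasure η (shift ξ))) := by
  have hind : IndepFun (fun x : Marks => x []) subtree (quenchedMeasure η ξ) :=
    indepFun_of_measurable_biSup_comap (fun u => measurable_pi_apply u)
      (iIndepFun_quenchedMeasure η ξ) (S := {[]}) (T := {[]}ᶜ) disjoint_compl_right
      (measurable_biSup_comap (X := fun (u : List ℕ) (x : Marks) => x u) (Set.mem_singleton _))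
      (@measurable_pi_lambda _ _ _ (_) _ _ fun i => @measurable_pi_lambda _ _ _ (_) _ _ fun v =>
        measurable_biSup_comap (X := fun (u : List ℕ) (x : Marks) => x u) (List.cons_ne_nil i v))
  refine ⟨by fun_prop, ?_⟩
  rw [(indepFun_iff_map_prod_eq_prod_map_map (measurable_pi_apply []).aemeasurable
    measurable_subtree.aemeasurable).1 hind, map_subtree_quenchedMeasure,
    (measurePreserving_eval_quenchedMeasure η ξ []).map_eq, List.length_nil]

theorem lintegral_mul_childSum_of_history {u : List ℕ} {H : Marks → ℝ≥0∞}
    (hH : Measurable[history u.length] H) :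
    ∫⁻ x, H x * childSum 1 (x u) ∂(quenchedMeasure η ξ) =
      (∫⁻ x, H x ∂(quenchedMeasure η ξ)) * m η u.length 1 ξ := by
  have hind : IndepFun H (fun x : Marks => x u) (quenchedMeasure η ξ) :=
    indepFun_of_measurable_biSup_comap (fun u => measurable_pi_apply u)
      (iIndepFun_quenchedMeasure η ξ) (S := {v | v.length < u.length}) (T := {u}) (by simp) hH
      (measurable_biSup_comap (X := fun (u : List ℕ) (x : Marks) => x u) (Set.mem_singleton _))
  have hroot := (measurePreserving_eval_quenchedMeasure η ξ u).lintegral_comp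
    (measurable_childSum 1)
  rw [show m η u.length 1 ξ = ∫⁻ y, childSum 1 y ∂(η (ξ u.length)) from rfl, ← hroot]
  exact lintegral_mul_eq_lintegral_mul_lintegral_of_indepFun (hH.mono (history_le _) le_rfl)
    (by fun_prop) (hind.comp measurable_id (measurable_childSum 1))

theorem lintegral_mul_mass_succ_of_history (n : ℕ) {H : Marks → ℝ≥0∞}
    (hH : Measurable[history n] H) :
    ∫⁻ x, H x * mass (n + 1) x ∂(quenchedMeasure η ξ) =
      (∫⁻ x, H x * mass n x ∂(quenchedMeasure η ξ)) * m η n 1 ξ := by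
  have hpast : ∀ u, Measurable[history n] fun x => H x * particleMass n u x := fun u =>
    hH.mul (measurable_particleMass n u)
  have hmeas : ∀ u, Measurable fun x => H x * particleMass n u x := fun u =>
    (hpast u).mono (history_le n) le_rfl
  have hmeasMul : ∀ u, Measurable fun x => H x * particleMass n u x * childSum 1 (x u) := fun u =>
    (hmeas u).mul (by fun_prop)
  simp_rw [mass_succ_eq_tsum, mass_eq_tsum, ← ENNReal.tsum_mul_left, ← mul_assoc]
  rw [lintegral_tsum fun u => (hmeasMul u).aemeasurable,
    lintegral_tsum fun u => (hmeas u).aemeasurable, ← ENNReal.tsum_mul_right]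
  refine tsum_congr fun u => ?_
  by_cases hu : u.length = n
  · subst hu
    exact lintegral_mul_childSum_of_history η ξ (hpast u)
  · simp [particleMass_of_length_ne hu]

theorem lintegral_mass (n : ℕ) : ∫⁻ x, mass n x ∂(quenchedMeasure η ξ) = P η n 1 ξ := by
  induction n with
  | zero => simp [mass_zero, P]
  | succ n ih =>
    have h := lintegral_mul_mass_succ_of_history η ξ n (H := fun _ => 1) measurable_const
    simp only [one_mul] at h
    rw [h, ih, P, P, Finset.prod_range_succ]

end Quenched

section QuenchedMoments

variable {Θ : Type*} [MeasurableSpace Θ] {η : Kernel Θ Mark} [IsMarkovKernel η] {ξ : ℕ → Θ}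
  {p : ℝ} {n : ℕ}

variable (η p n) in
/-- `𝔼_ξ (∑_{|u| = n} exp (S_u))^p`. -/
noncomputable def quenchedMoment (ξ : ℕ → Θ) : ℝ≥0∞ := ∫⁻ x, mass n x ^ p ∂(quenchedMeasure η ξ)

/-- A lower bound for the masses of two different children, `0` if there are fewer than two. -/
noncomputable def pairMass (y : Mark) : ℝ≥0∞ :=
  if 1 < y.1 then min (weight y 0) (weight y 1) else 0

@[fun_prop]
theorem measurable_pairMass : Measurable pairMass :=
  Measurable.ite (measurableSet_lt measurable_const measurable_fst) (by fun_prop) measurable_const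

@[fun_prop]
theorem measurable_quenchedMoment : Measurable (quenchedMoment η p n) :=
  ((measurable_mass n).pow_const p).lintegral_kernel (κ := quenched η)

theorem quenchedMoment_one : quenchedMoment η p 1 ξ = ∫⁻ y, childSum 1 y ^ p ∂(η (ξ 0)) := by
  simp_rw [quenchedMoment, mass_one]
  exact (measurePreserving_eval_quenchedMeasure η ξ []).lintegral_comp
    (f := fun y => childSum 1 y ^ p) (by fun_prop)

theorem quenchedMoment_succ :
    quenchedMoment η p (n + 1) ξ = ∫⁻ y, ∫⁻ z,
      (∑ i ∈ Finset.range y.1, weight y i * mass n (z i)) ^ p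
        ∂(Measure.infinitePi fun _ : ℕ => quenchedMeasure η (shift ξ)) ∂(η (ξ 0)) := by
  have hmeas : Measurable fun q : Mark × (ℕ → Marks) =>
      (∑ i ∈ Finset.range q.1.1, weight q.1 i * mass n (q.2 i)) ^ p :=
    (measurable_sum_range_comp (by fun_prop) fun i => by fun_prop).pow_const p
  simp_rw [quenchedMoment, mass_succ]
  rw [← lintegral_prod _ hmeas.aemeasurable,
    ← (measurePreserving_root_subtree η ξ).lintegral_comp hmeas]

section IndependentCopies

variable {ν : Measure Marks} [IsProbabilityMeasure ν]

theorem lintegral_mass_eval_rpow (i : ℕ) :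
    ∫⁻ z, mass n (z i) ^ p ∂(Measure.infinitePi fun _ : ℕ => ν) = ∫⁻ x, mass n x ^ p ∂ν :=
  (measurePreserving_eval_infinitePi (fun _ : ℕ => ν) i).lintegral_comp
    (f := fun x => mass n x ^ p) (by fun_prop)

theorem iIndepFun_mass_eval :
    iIndepFun (fun (i : ℕ) (z : ℕ → Marks) => mass n (z i)) (Measure.infinitePi fun _ => ν) :=
  iIndepFun_infinitePi (X := fun _ => mass n) fun _ => measurable_mass n

end IndependentCopies

theorem quenchedMoment_succ_le (hp : 1 < p) {r C : ℝ≥0∞}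
    (hC : ∀ x y : ℝ≥0∞, (x + y) ^ (p - 1) ≤ r * x ^ (p - 1) + C * y ^ (p - 1))
    (hξ : P η n 1 (shift ξ) ≤ 1) (K : ℝ≥0∞) :
    quenchedMoment η p (n + 1) ξ ≤ r * (m η 0 p ξ * quenchedMoment η p n (shift ξ)) +
      C * (quenchedMoment η p 1 ξ * (K ^ (p - 1) + K⁻¹ * quenchedMoment η p n (shift ξ))) := by
  set ν := quenchedMeasure η (shift ξ)
  set v := quenchedMoment η p n (shift ξ)
  have hmean : ∀ i : ℕ, ∫⁻ z, mass n (z i) ∂(Measure.infinitePi fun _ : ℕ => ν) ≤ 1 := fun i => by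
    rw [(measurePreserving_eval_infinitePi (fun _ : ℕ => ν) i).lintegral_comp (measurable_mass n),
      lintegral_mass]
    exact hξ
  calc quenchedMoment η p (n + 1) ξ
      ≤ ∫⁻ y, r * (childSum p y * v) + C * (childSum 1 y ^ p * (K ^ (p - 1) + K⁻¹ * v))
          ∂(η (ξ 0)) := by
        rw [quenchedMoment_succ]
        refine lintegral_mono fun y => ?_
        rw [childSum_eq_sum_rpow, childSum_one]
        exact lintegral_rpow_sum_mul_le hp hC (fun i => by fun_prop)
          (fun i j hij => iIndepFun_mass_eval.indepFun hij) hmean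
          (fun i => (lintegral_mass_eval_rpow i).le) _ _ K
    _ = _ := by
        rw [lintegral_add_left (by fun_prop), lintegral_const_mul _ (by fun_prop),
          lintegral_mul_const _ (by fun_prop), lintegral_const_mul _ (by fun_prop),
          lintegral_mul_const _ (by fun_prop), ← quenchedMoment_one]
        rfl

theorem sum_add_pairMass_le (hp : 1 ≤ p) (y : Mark) (w : ℕ → ℝ≥0∞) :
    ∑ i ∈ Finset.range y.1, weight y i ^ p * w i ^ p +
        (2 ^ (p - 1) - 1) * (pairMass y ^ p * min (w 0) (w 1) ^ p) ≤
      (∑ i ∈ Finset.range y.1, weight y i * w i) ^ p := by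
  have hp0 : 0 < p := by linarith
  simp_rw [← ENNReal.mul_rpow_of_nonneg _ _ hp0.le]
  by_cases hy : 1 < y.1
  · refine le_trans ?_ (sum_rpow_add_min_rpow_le hp (Finset.mem_range.2 (zero_lt_one.trans hy))
      (Finset.mem_range.2 hy) zero_ne_one fun i => weight y i * w i)
    rw [pairMass, if_pos hy]
    gcongr
    exact le_min (mul_le_mul' (min_le_left _ _) (min_le_left _ _))
      (mul_le_mul' (min_le_right _ _) (min_le_right _ _))
  · rw [pairMass, if_neg hy, zero_mul, ENNReal.zero_rpow_of_pos hp0, mul_zero, add_zero]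
    exact sum_rpow_le_rpow_sum hp _ _

theorem le_quenchedMoment_succ (hp : 1 ≤ p) (s : ℝ≥0∞) :
    m η 0 p ξ * quenchedMoment η p n (shift ξ) +
        (2 ^ (p - 1) - 1) * ((∫⁻ y, pairMass y ^ p ∂(η (ξ 0))) *
          (s ^ p * quenched η (shift ξ) {x | s ≤ mass n x} ^ 2)) ≤
      quenchedMoment η p (n + 1) ξ := by
  set ν := Measure.infinitePi fun _ : ℕ => quenchedMeasure η (shift ξ)
  set v := quenchedMoment η p n (shift ξ)
  set κ := s ^ p * quenched η (shift ξ) {x | s ≤ mass n x} ^ 2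
  have hκ : κ ≤ ∫⁻ z, min (mass n (z 0)) (mass n (z 1)) ^ p ∂ν := by
    have heval : ∀ i : ℕ, ν {z | s ≤ mass n (z i)} = quenched η (shift ξ) {x | s ≤ mass n x} :=
      fun i => (measurePreserving_eval_infinitePi
        (fun _ : ℕ => quenchedMeasure η (shift ξ)) i).measure_preimage (s := {x | s ≤ mass n x})
        (measurableSet_le measurable_const (measurable_mass n)).nullMeasurableSet
    have h := rpow_mul_measure_mul_le_lintegral_min_rpow (p := p) (by fun_prop) (by fun_prop)
      (iIndepFun_mass_eval (n := n) (ν := quenchedMeasure η (shift ξ)) |>.indepFun zero_ne_one)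
      (by linarith) s
    rwa [heval, heval, ← sq] at h
  calc _ = ∫⁻ y, childSum p y * v + (2 ^ (p - 1) - 1) * (pairMass y ^ p * κ) ∂(η (ξ 0)) := by
        rw [lintegral_add_left (by fun_prop), lintegral_mul_const _ (by fun_prop),
          lintegral_const_mul _ (by fun_prop), lintegral_mul_const _ (by fun_prop)]
        rfl
    _ ≤ _ := ?_
  rw [quenchedMoment_succ]
  refine lintegral_mono fun y => le_trans ?_ (lintegral_mono fun z =>
    sum_add_pairMass_le hp y fun i => mass n (z i))
  rw [lintegral_add_left (by fun_prop), lintegral_const_mul _ (by fun_prop),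
    lintegral_const_mul _ (by fun_prop), lintegral_finsetSum _ fun i _ => by fun_prop,
    childSum_eq_sum_rpow, Finset.sum_mul]
  gcongr with i
  rw [lintegral_const_mul _ (by fun_prop), lintegral_mass_eval_rpow]
  rfl

end QuenchedMoments

section AnnealedMoments

variable {Θ : Type*} [MeasurableSpace Θ] {τ : Measure (ℕ → Θ)} [IsProbabilityMeasure τ]
  {η : Kernel Θ Mark} [IsMarkovKernel η] {p : ℝ}

instance : IsProbabilityMeasure (annealed τ η) := by
  unfold annealed; infer_instance

variable (τ η p) in
/-- `𝔼 (∑_{|u| = n} exp (S_u))^p`. -/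
noncomputable def annealedMoment (n : ℕ) : ℝ≥0∞ := ∫⁻ ω, mass n ω.2 ^ p ∂(annealed τ η)

theorem annealedMoment_eq_lintegral (n : ℕ) :
    annealedMoment τ η p n = ∫⁻ ξ, quenchedMoment η p n ξ ∂τ :=
  Measure.lintegral_compProd (f := fun ω => mass n ω.2 ^ p) (by fun_prop)

theorem annealedMoment_zero : annealedMoment τ η p 0 = 1 := by
  simp [annealedMoment, mass_zero]

theorem lintegral_mass_annealed (hmean : ∀ᵐ ξ ∂τ, ∀ n, m η n 1 ξ = 1) (n : ℕ) :
    ∫⁻ ω, mass n ω.2 ∂(annealed τ η) = 1 := by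
  rw [annealed, Measure.lintegral_compProd (by fun_prop)]
  trans ∫⁻ _, 1 ∂τ
  · refine lintegral_congr_ae (hmean.mono fun ξ hξ => ?_)
    exact (lintegral_mass η ξ n).trans (P_eq_one hξ n)
  · simp

theorem annealedMoment_succ_le (hp : 1 < p)
    (hτ : MeasurePreserving (fun ξ : ℕ → Θ => (ξ 0, shift ξ)) τ ((τ.map fun ξ => ξ 0).prod τ))
    (hmean : ∀ᵐ ξ ∂τ, ∀ n, m η n 1 ξ = 1) {r C : ℝ≥0∞}
    (hC : ∀ x y : ℝ≥0∞, (x + y) ^ (p - 1) ≤ r * x ^ (p - 1) + C * y ^ (p - 1))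
    (K : ℝ≥0∞) (n : ℕ) :
    annealedMoment τ η p (n + 1) ≤ r * ((∫⁻ ξ, m η 0 p ξ ∂τ) * annealedMoment τ η p n) +
      C * (annealedMoment τ η p 1 * (K ^ (p - 1) + K⁻¹ * annealedMoment τ η p n)) := by
  have hroot_mul {g : (ℕ → Θ) → ℝ≥0∞} (hg : Measurable g) :
      ∫⁻ ξ, quenchedMoment η p 1 ξ * g (shift ξ) ∂τ = annealedMoment τ η p 1 * ∫⁻ ξ, g ξ ∂τ := by
    simp_rw [annealedMoment_eq_lintegral, quenchedMoment_one]
    exact lintegral_lintegral_kernel_mul_shift hτ (by fun_prop) hg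
  have hm_mul : ∫⁻ ξ, m η 0 p ξ * quenchedMoment η p n (shift ξ) ∂τ =
      (∫⁻ ξ, m η 0 p ξ ∂τ) * ∫⁻ ξ, quenchedMoment η p n ξ ∂τ :=
    lintegral_lintegral_kernel_mul_shift hτ (measurable_childSum p) (by fun_prop)
  rw [annealedMoment_eq_lintegral (n + 1)]
  refine (lintegral_mono_ae (hmean.mono fun ξ hξ =>
    quenchedMoment_succ_le hp hC (P_eq_one (fun k => hξ (k + 1)) n).le K)).trans_eq ?_
  rw [lintegral_add_left (by fun_prop), lintegral_const_mul _ (by fun_prop),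
    lintegral_const_mul _ (by fun_prop), hm_mul,
    hroot_mul (g := fun ξ => K ^ (p - 1) + K⁻¹ * quenchedMoment η p n ξ) (by fun_prop),
    lintegral_add_left (by fun_prop), lintegral_const_mul _ (by fun_prop),
    ← annealedMoment_eq_lintegral]
  simp

theorem iSup_annealedMoment_lt_top (hp : 1 < p)
    (hτ : MeasurePreserving (fun ξ : ℕ → Θ => (ξ 0, shift ξ)) τ ((τ.map fun ξ => ξ 0).prod τ))
    (hmean : ∀ᵐ ξ ∂τ, ∀ n, m η n 1 ξ = 1) (h1 : annealedMoment τ η p 1 < ∞)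
    (hb : ∫⁻ ξ, m η 0 p ξ ∂τ < 1) : ⨆ n, annealedMoment τ η p n < ∞ := by
  set b := ∫⁻ ξ, m η 0 p ξ ∂τ
  set v := annealedMoment τ η p 1
  obtain ⟨c, hbc, hc⟩ := exists_between hb
  have hc0 : c ≠ 0 := (zero_le.trans_lt hbc).ne'
  have hrb : c⁻¹ * b < 1 := by
    rw [mul_comm, ← div_eq_mul_inv]
    exact ENNReal.div_lt_of_lt_mul (by rwa [one_mul])
  obtain ⟨C, hC, hadd⟩ := exists_add_rpow_le (sub_pos.2 hp) (ENNReal.one_lt_inv.2 hc)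
    (ENNReal.inv_ne_top.2 hc0)
  obtain ⟨k, hk⟩ := ENNReal.exists_nat_mul_gt (tsub_pos_of_lt hrb).ne'
    (ENNReal.mul_ne_top hC h1.ne)
  have hcontract : c⁻¹ * b + (k : ℝ≥0∞)⁻¹ * (C * v) < 1 := by
    rw [← lt_tsub_iff_left, mul_comm, ← div_eq_mul_inv]
    exact ENNReal.div_lt_of_lt_mul (by rwa [mul_comm (1 - c⁻¹ * b)])
  refine iSup_lt_top_of_le_mul_add (by simp [annealedMoment_zero]) hcontract
    (d := C * v * (k : ℝ≥0∞) ^ (p - 1)) (by have := h1.ne; finiteness) fun n => ?_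
  exact (annealedMoment_succ_le hp hτ hmean hadd k n).trans_eq (by ring)

theorem le_annealedMoment_succ (hp : 1 ≤ p)
    (hτ : MeasurePreserving (fun ξ : ℕ → Θ => (ξ 0, shift ξ)) τ ((τ.map fun ξ => ξ 0).prod τ))
    (s : ℝ≥0∞) (n : ℕ) :
    (∫⁻ ξ, m η 0 p ξ ∂τ) * annealedMoment τ η p n +
        (2 ^ (p - 1) - 1) * ((∫⁻ ξ, ∫⁻ y, pairMass y ^ p ∂(η (ξ 0)) ∂τ) *
          (s ^ p * annealed τ η {ω | s ≤ mass n ω.2} ^ 2)) ≤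
      annealedMoment τ η p (n + 1) := by
  have hset : MeasurableSet {x | s ≤ mass n x} := measurableSet_le measurable_const (by fun_prop)
  have hprob : Measurable fun ξ => quenched η ξ {x | s ≤ mass n x} :=
    (quenched η).measurable_coe hset
  have hjensen : annealed τ η {ω | s ≤ mass n ω.2} ^ 2 ≤
      ∫⁻ ξ, quenched η ξ {x | s ≤ mass n x} ^ 2 ∂τ := by
    rw [show annealed τ η {ω | s ≤ mass n ω.2} = ∫⁻ ξ, quenched η ξ {x | s ≤ mass n x} ∂τ from
      Measure.compProd_apply (measurable_snd hset)]
    exact_mod_cast rpow_lintegral_le_lintegral_rpow (p := (2 : ℕ)) (by norm_num) hprob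
  have hm_mul : ∫⁻ ξ, m η 0 p ξ * quenchedMoment η p n (shift ξ) ∂τ =
      (∫⁻ ξ, m η 0 p ξ ∂τ) * annealedMoment τ η p n := by
    rw [annealedMoment_eq_lintegral]
    exact lintegral_lintegral_kernel_mul_shift hτ (measurable_childSum p) (by fun_prop)
  rw [annealedMoment_eq_lintegral (n + 1)]
  refine le_trans ?_ (lintegral_mono fun ξ => le_quenchedMoment_succ hp s)
  rw [lintegral_add_left (by fun_prop), lintegral_const_mul _ (by fun_prop), hm_mul,
    lintegral_lintegral_kernel_mul_shift hτ (f := fun y => pairMass y ^ p) (by fun_prop)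
      (g := fun ξ => s ^ p * quenched η ξ {x | s ≤ mass n x} ^ 2) (by fun_prop),
    lintegral_const_mul _ (by fun_prop)]
  gcongr

theorem pairMass_eq_zero_iff {y : Mark} : pairMass y = 0 ↔ y.1 ≤ 1 := by
  simp [pairMass, weight, (Real.exp_pos _).not_ge]

theorem childSum_one_rpow_of_pairMass_eq_zero (hp : 0 < p) {y : Mark} (hy : pairMass y = 0) :
    childSum 1 y ^ p = childSum p y := by
  rw [childSum_one, childSum_eq_sum_rpow]
  rcases Nat.le_one_iff_eq_zero_or_eq_one.1 (pairMass_eq_zero_iff.1 hy) with h | h <;>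
    simp [h, ENNReal.zero_rpow_of_pos hp]

theorem annealedMoment_one_of_pairMass_eq_zero (hp : 0 < p)
    (hpair : ∫⁻ ξ, ∫⁻ y, pairMass y ^ p ∂(η (ξ 0)) ∂τ = 0) :
    annealedMoment τ η p 1 = ∫⁻ ξ, m η 0 p ξ ∂τ := by
  rw [lintegral_eq_zero_iff (measurable_lintegral_kernel_eval (by fun_prop) 0)] at hpair
  simp_rw [annealedMoment_eq_lintegral, quenchedMoment_one]
  refine lintegral_congr_ae (hpair.mono fun ξ hξ => lintegral_congr_ae ?_)
  refine ((lintegral_eq_zero_iff (by fun_prop)).1 hξ).mono fun y hy =>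
    childSum_one_rpow_of_pairMass_eq_zero hp ?_
  simpa [ENNReal.rpow_eq_zero_iff, hp, hp.not_gt] using hy

theorem lintegral_m_lt_one_of_iSup_annealedMoment_lt_top (hp : 1 < p)
    (hτ : MeasurePreserving (fun ξ : ℕ → Θ => (ξ 0, shift ξ)) τ ((τ.map fun ξ => ξ 0).prod τ))
    (hmean : ∀ᵐ ξ ∂τ, ∀ n, m η n 1 ξ = 1)
    (hnontrivial : ¬ ∀ᵐ ω ∂(annealed τ η), mass 1 ω.2 = 1)
    (hsup : ⨆ n, annealedMoment τ η p n < ∞) : ∫⁻ ξ, m η 0 p ξ ∂τ < 1 := by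
  by_contra! hb
  obtain ⟨δ, hδ, hmeasure⟩ := exists_ne_zero_le_measure_half_le (μ := annealed τ η) hp hsup.ne
  have hδn : ∀ n, δ ≤ annealed τ η {ω | 2⁻¹ ≤ mass n ω.2} := fun n =>
    hmeasure (by fun_prop) (lintegral_mass_annealed hmean n) (le_iSup (annealedMoment τ η p) n)
  obtain ⟨hone, hzero⟩ := eq_one_and_eq_zero_of_mul_add_le annealedMoment_zero hsup hb
    (d := (2 ^ (p - 1) - 1) * ((∫⁻ ξ, ∫⁻ y, pairMass y ^ p ∂(η (ξ 0)) ∂τ) * (2⁻¹ ^ p * δ ^ 2)))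
    fun n => le_trans (by gcongr; exact hδn n) (le_annealedMoment_succ hp.le hτ 2⁻¹ n)
  have hgain : (2 : ℝ≥0∞) ^ (p - 1) - 1 ≠ 0 :=
    (tsub_pos_of_lt (ENNReal.one_lt_rpow ENNReal.one_lt_two (sub_pos.2 hp))).ne'
  have hpair : ∫⁻ ξ, ∫⁻ y, pairMass y ^ p ∂(η (ξ 0)) ∂τ = 0 := by
    simpa [hgain, hδ, ENNReal.rpow_eq_zero_iff] using hzero
  refine hnontrivial (ae_eq_one_of_lintegral_rpow_le_one hp (by fun_prop)
    (lintegral_mass_annealed hmean 1) ?_)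
  exact ((annealedMoment_one_of_pairMass_eq_zero (by linarith) hpair).trans hone).le

theorem iSup_annealedMoment_lt_top_iff (hp : 1 < p)
    (hτ : MeasurePreserving (fun ξ : ℕ → Θ => (ξ 0, shift ξ)) τ ((τ.map fun ξ => ξ 0).prod τ))
    (hmean : ∀ᵐ ξ ∂τ, ∀ n, m η n 1 ξ = 1)
    (hnontrivial : ¬ ∀ᵐ ω ∂(annealed τ η), mass 1 ω.2 = 1) :
    ⨆ n, annealedMoment τ η p n < ∞ ↔
      annealedMoment τ η p 1 < ∞ ∧ ∫⁻ ξ, m η 0 p ξ ∂τ < 1 :=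
  ⟨fun hsup => ⟨(le_iSup _ 1).trans_lt hsup,
      lintegral_m_lt_one_of_iSup_annealedMoment_lt_top hp hτ hmean hnontrivial hsup⟩,
    fun ⟨h1, hb⟩ => iSup_annealedMoment_lt_top hp hτ hmean h1 hb⟩

end AnnealedMoments

section MartingaleLp

variable {Ω : Type*} {mΩ : MeasurableSpace Ω} {μ : Measure Ω}

theorem unifIntegrable_of_eLpNorm_le {ι E : Type*} [NormedAddCommGroup E] {p q : ℝ≥0∞}
    (hq : q ≠ 0) (hqp : q < p) {f : ι → Ω → E} (hf : ∀ i, AEStronglyMeasurable (f i) μ)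
    {R : ℝ≥0∞} (hR : R ≠ ∞) (hbound : ∀ i, eLpNorm (f i) p μ ≤ R) : UnifIntegrable f q μ := by
  set s := 1 / q.toReal - 1 / p.toReal with hs_def
  have hs : 0 < s := by
    have hq_pos : 0 < q.toReal := ENNReal.toReal_pos hq hqp.ne_top
    rcases eq_or_ne p ∞ with rfl | hp
    · simpa [hs_def] using hq_pos
    · exact sub_pos.2 (one_div_lt_one_div_of_lt hq_pos (ENNReal.toReal_strict_mono hp hqp))
  intro ε hε
  have hlim : Tendsto (fun δ : ℝ≥0∞ => R * δ ^ s) (𝓝 0) (𝓝 0) := by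
    have hpow := (ENNReal.continuous_rpow_const (y := s)).tendsto 0
    rw [ENNReal.zero_rpow_of_pos hs] at hpow
    simpa using ENNReal.Tendsto.const_mul hpow (.inr hR)
  obtain ⟨δ, hδ, hsmall⟩ := ENNReal.nhds_zero_basis_Iic.eventually_iff.1
    (hlim.eventually (gt_mem_nhds (ENNReal.ofReal_pos.2 hε)))
  have hδ' : min δ 1 ≠ ∞ := ((min_le_right _ _).trans_lt ENNReal.one_lt_top).ne
  refine ⟨(min δ 1).toReal, ENNReal.toReal_pos (lt_min hδ zero_lt_one).ne' hδ',
    fun i A hA hμA => ?_⟩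
  rw [ENNReal.ofReal_toReal hδ'] at hμA
  calc eLpNorm (A.indicator (f i)) q μ
      = eLpNorm (f i) q (μ.restrict A) := eLpNorm_indicator_eq_eLpNorm_restrict hA
    _ ≤ eLpNorm (f i) p (μ.restrict A) * (μ.restrict A) Set.univ ^ s :=
        eLpNorm_le_eLpNorm_mul_rpow_measure_univ hqp.le (hf i).restrict
    _ ≤ R * μ A ^ s := by
        rw [Measure.restrict_apply_univ]
        gcongr
        exact (eLpNorm_restrict_le _ _ _ _).trans (hbound i)
    _ ≤ ENNReal.ofReal ε := (hsmall (hμA.trans (min_le_left _ _))).le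

variable {p : ℝ}

theorem eLpNorm_rpow_le_eLpNorm_one (hp : 0 < p) {f h : Ω → ℝ}
    (hfh : ∀ᵐ ω ∂μ, ‖f ω‖ ^ p ≤ h ω) :
    eLpNorm f (ENNReal.ofReal p) μ ^ p ≤ eLpNorm h 1 μ := by
  rw [eLpNorm_eq_lintegral_rpow_enorm_toReal (by simpa using hp) ENNReal.ofReal_ne_top,
    ENNReal.toReal_ofReal hp.le, ← ENNReal.rpow_mul, one_div_mul_cancel hp.ne',
    ENNReal.rpow_one, eLpNorm_one_eq_lintegral_enorm]
  refine lintegral_mono_ae (hfh.mono fun ω hω => ?_)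
  rw [← ofReal_norm, ← ofReal_norm, ENNReal.ofReal_rpow_of_nonneg (norm_nonneg _) hp.le]
  exact ENNReal.ofReal_le_ofReal (hω.trans (le_abs_self _))

variable {f : ℕ → Ω → ℝ} {g : Ω → ℝ}

theorem ConvergesInLp.iSup_eLpNorm_lt_top (hp : 1 ≤ p) (h : ConvergesInLp μ p f g) :
    ⨆ n, eLpNorm (f n) (ENNReal.ofReal p) μ < ∞ := by
  obtain ⟨hf, hg, hlim⟩ := h
  obtain ⟨C, hC⟩ := ((ENNReal.tendsto_toReal ENNReal.zero_ne_top).comp hlim).bddAbove_range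
  refine (iSup_le fun n => ?_).trans_lt
    (ENNReal.add_lt_top.2 ⟨ENNReal.ofReal_lt_top (r := C), hg.eLpNorm_lt_top⟩)
  have hsub : MemLp (f n - g) (ENNReal.ofReal p) μ := (hf n).sub hg
  calc eLpNorm (f n) (ENNReal.ofReal p) μ
      = eLpNorm (f n - g + g) (ENNReal.ofReal p) μ := by rw [sub_add_cancel]
    _ ≤ eLpNorm (f n - g) (ENNReal.ofReal p) μ + eLpNorm g (ENNReal.ofReal p) μ :=
        eLpNorm_add_le hsub.1 hg.1 (ENNReal.one_le_ofReal.2 hp)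
    _ ≤ ENNReal.ofReal C + eLpNorm g (ENNReal.ofReal p) μ := by
        gcongr
        exact (ENNReal.le_ofReal_iff_toReal_le hsub.2.ne
          (ENNReal.toReal_nonneg.trans (hC ⟨n, rfl⟩))).2 (hC ⟨n, rfl⟩)

variable [IsFiniteMeasure μ] {ℱ : Filtration ℕ mΩ}

theorem unifIntegrable_condExp (hp : 1 ≤ p) (hg : MemLp g (ENNReal.ofReal p) μ) :
    UnifIntegrable (fun n => μ[g | ℱ n]) (ENNReal.ofReal p) μ := by
  have hp0 : 0 < p := by linarith
  have hgp : Integrable (fun ω => ‖g ω‖ ^ p) μ := by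
    simpa [hp0.le] using hg.integrable_norm_rpow (by simpa using hp0) ENNReal.ofReal_ne_top
  intro ε hε
  obtain ⟨δ, hδ, hsmall⟩ :=
    (hgp.uniformIntegrable_condExp_filtration (f := ℱ)).unifIntegrable (Real.rpow_pos_of_pos hε p)
  refine ⟨δ, hδ, fun n A hA hμA => (ENNReal.rpow_le_rpow_iff hp0).1 ?_⟩
  rw [ENNReal.ofReal_rpow_of_pos hε]
  refine le_trans ?_ (hsmall n A hA hμA)
  rw [eLpNorm_indicator_eq_eLpNorm_restrict hA, eLpNorm_indicator_eq_eLpNorm_restrict hA]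
  exact eLpNorm_rpow_le_eLpNorm_one hp0
    (ae_restrict_of_ae (Integrable.norm_condExp_rpow_le (m := ℱ n) hp hgp))

theorem convergesInLp_of_martingale (hp : 1 < p) (hf : Martingale f ℱ μ)
    (hg : ∀ᵐ ω ∂μ, Tendsto (fun n => f n ω) atTop (𝓝 (g ω)))
    (hbound : ⨆ n, eLpNorm (f n) (ENNReal.ofReal p) μ < ∞) : ConvergesInLp μ p f g := by
  have hp' : 1 < ENNReal.ofReal p := ENNReal.one_lt_ofReal.2 hp
  have hle : ∀ n, eLpNorm (f n) (ENNReal.ofReal p) μ ≤ ⨆ n, eLpNorm (f n) (ENNReal.ofReal p) μ :=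
    le_iSup fun n => eLpNorm (f n) (ENNReal.ofReal p) μ
  have hmeas : ∀ n, AEStronglyMeasurable (f n) μ := fun n => (hf.integrable n).aestronglyMeasurable
  have hgp : MemLp g (ENNReal.ofReal p) μ := ⟨aestronglyMeasurable_of_tendsto_ae atTop hmeas hg,
    (Lp.eLpNorm_le_of_ae_tendsto (Eventually.of_forall hle) hmeas hg).trans_lt hbound⟩
  have hg1 : MemLp g 1 μ := hgp.mono_exponent hp'.le
  have hL1 : Tendsto (fun n => eLpNorm (f n - g) 1 μ) atTop (𝓝 0) :=
    tendsto_Lp_finite_of_tendsto_ae le_rfl ENNReal.one_ne_top hmeas hg1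
      (unifIntegrable_of_eLpNorm_le one_ne_zero hp' hmeas hbound.ne hle) hg
  have hclosed : ∀ n, f n =ᵐ[μ] μ[g | ℱ n] :=
    hf.eq_condExp_of_tendsto_eLpNorm (hg1.integrable le_rfl) hL1
  have hui : UnifIntegrable f (ENNReal.ofReal p) μ :=
    (unifIntegrable_condExp hp.le hgp (ℱ := ℱ)).ae_eq fun n => (hclosed n).symm
  exact ⟨fun n => ⟨hmeas n, (hle n).trans_lt hbound⟩, hgp,
    tendsto_Lp_finite_of_tendsto_ae hp'.le ENNReal.ofReal_ne_top hmeas hgp hui hg⟩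

theorem convergesInLp_iff_of_martingale (hp : 1 < p) (hf : Martingale f ℱ μ)
    (hg : ∀ᵐ ω ∂μ, Tendsto (fun n => f n ω) atTop (𝓝 (g ω))) :
    ConvergesInLp μ p f g ↔ ⨆ n, eLpNorm (f n) (ENNReal.ofReal p) μ < ∞ :=
  ⟨fun h => h.iSup_eLpNorm_lt_top hp.le, convergesInLp_of_martingale hp hf hg⟩

end MartingaleLp

section Martingale

variable {Θ : Type*} [MeasurableSpace Θ] {τ : Measure (ℕ → Θ)} {η : Kernel Θ Mark}

/-- The filtration generated by the whole environment and the reproduction vectors of the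
particles of generations less than `n`; including the whole environment makes the normalization
`P_n` adapted. -/
def past (Θ : Type*) [MeasurableSpace Θ] :
    Filtration ℕ (inferInstance : MeasurableSpace ((ℕ → Θ) × Marks)) where
  seq n := MeasurableSpace.prod inferInstance (history n)
  mono' _ _ h := sup_le_sup le_rfl (MeasurableSpace.comap_mono (history_mono h))
  le' n := sup_le_sup le_rfl (MeasurableSpace.comap_mono (history_le n))

theorem W_eq_toReal_mass_div (n : ℕ) (ω : (ℕ → Θ) × Marks) :
    W η n ω = (mass n ω.2).toReal / (P η n 1 ω.1).toReal := by
  rw [toReal_mass, W, Wt]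

theorem measurable_past_W (n : ℕ) : Measurable[past Θ n] (W η n) := by
  rw [funext (W_eq_toReal_mass_div n)]
  have hP : Measurable (P η n 1) := by unfold P; fun_prop
  have hmass : Measurable[past Θ n] fun ω : (ℕ → Θ) × Marks => mass n ω.2 :=
    (measurable_history_mass n).comp (@measurable_snd _ _ _ (history n))
  exact hmass.ennreal_toReal.div (hP.comp (@measurable_fst _ _ _ (history n))).ennreal_toReal

variable [IsMarkovKernel η]

theorem ae_W_eq (hmean : ∀ᵐ ξ ∂τ, ∀ n, m η n 1 ξ = 1) :
    ∀ᵐ ω ∂(annealed τ η), ∀ n, W η n ω = (mass n ω.2).toReal := by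
  have hset : MeasurableSet {ξ | ∀ n, m η n 1 ξ = 1} := by
    simp only [Set.ofPred_forall]
    exact .iInter fun n => measurableSet_eq_fun (measurable_m n 1) measurable_const
  filter_upwards [Measure.ae_compProd_of_ae_fst (quenched η) hset hmean] with ω hω n
  rw [W_eq_toReal_mass_div, P_eq_one hω, ENNReal.toReal_one, div_one]

theorem ae_ofReal_W_eq (hmean : ∀ᵐ ξ ∂τ, ∀ n, m η n 1 ξ = 1) :
    ∀ᵐ ω ∂(annealed τ η), ∀ n, 0 ≤ W η n ω ∧ ENNReal.ofReal (W η n ω) = mass n ω.2 := by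
  filter_upwards [ae_W_eq hmean] with ω hω n
  rw [hω]
  exact ⟨ENNReal.toReal_nonneg, ENNReal.ofReal_toReal (mass_ne_top n _)⟩

theorem lintegral_W_rpow (hmean : ∀ᵐ ξ ∂τ, ∀ n, m η n 1 ξ = 1) {p : ℝ} (hp : 0 ≤ p) (n : ℕ) :
    ∫⁻ ω, ENNReal.ofReal (W η n ω ^ p) ∂(annealed τ η) = annealedMoment τ η p n := by
  refine lintegral_congr_ae ((ae_ofReal_W_eq hmean).mono fun ω hω => ?_)
  simp only [← ENNReal.ofReal_rpow_of_nonneg (hω n).1 hp, (hω n).2]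

theorem eLpNorm_W_rpow (hmean : ∀ᵐ ξ ∂τ, ∀ n, m η n 1 ξ = 1) {p : ℝ} (hp : 0 < p) (n : ℕ) :
    eLpNorm (W η n) (ENNReal.ofReal p) (annealed τ η) ^ p = annealedMoment τ η p n := by
  rw [eLpNorm_eq_lintegral_rpow_enorm_toReal (by simpa using hp) ENNReal.ofReal_ne_top,
    ENNReal.toReal_ofReal hp.le, ← ENNReal.rpow_mul, one_div_mul_cancel hp.ne', ENNReal.rpow_one]
  refine lintegral_congr_ae ((ae_ofReal_W_eq hmean).mono fun ω hω => ?_)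
  simp only [Real.enorm_of_nonneg (hω n).1, (hω n).2]

variable [IsProbabilityMeasure τ]

theorem lintegral_mul_mass_succ_of_past (hmean : ∀ᵐ ξ ∂τ, ∀ n, m η n 1 ξ = 1) (n : ℕ)
    {H : (ℕ → Θ) × Marks → ℝ≥0∞} (hH : Measurable[past Θ n] H) :
    ∫⁻ ω, H ω * mass (n + 1) ω.2 ∂(annealed τ η) = ∫⁻ ω, H ω * mass n ω.2 ∂(annealed τ η) := by
  have hH' : Measurable H := hH.mono ((past Θ).le n) le_rfl
  rw [annealed, Measure.lintegral_compProd (by fun_prop), Measure.lintegral_compProd (by fun_prop)]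
  refine lintegral_congr_ae (hmean.mono fun ξ hξ => ?_)
  have hslice : Measurable[history n] fun x => H (ξ, x) :=
    hH.comp (@measurable_prodMk_left _ _ _ (history n) ξ)
  exact (lintegral_mul_mass_succ_of_history η ξ n hslice).trans (by rw [hξ n, mul_one]; rfl)

theorem eLpNorm_one_W (hmean : ∀ᵐ ξ ∂τ, ∀ n, m η n 1 ξ = 1) (n : ℕ) :
    eLpNorm (W η n) 1 (annealed τ η) = 1 := by
  have hmoment := eLpNorm_W_rpow hmean zero_lt_one n
  simpa [annealedMoment, lintegral_mass_annealed hmean] using hmoment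

theorem integrable_W (hmean : ∀ᵐ ξ ∂τ, ∀ n, m η n 1 ξ = 1) (n : ℕ) :
    Integrable (W η n) (annealed τ η) :=
  memLp_one_iff_integrable.1
    ⟨((measurable_past_W n).mono ((past Θ).le n) le_rfl).aestronglyMeasurable,
      (eLpNorm_one_W hmean n).trans_lt ENNReal.one_lt_top⟩

theorem martingale_W (hmean : ∀ᵐ ξ ∂τ, ∀ n, m η n 1 ξ = 1) :
    Martingale (W η) (past Θ) (annealed τ η) := by
  refine martingale_of_setIntegral_eq_succ (fun n => (measurable_past_W n).stronglyMeasurable)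
    (integrable_W hmean) fun n s hs => ?_
  have hs' : MeasurableSet s := (past Θ).le n s hs
  have hsetIntegral (k : ℕ) : ∫ ω in s, W η k ω ∂(annealed τ η) =
      (∫⁻ ω, s.indicator (fun _ => 1) ω * mass k ω.2 ∂(annealed τ η)).toReal := by
    rw [setIntegral_congr_ae hs' ((ae_W_eq hmean).mono fun ω hω _ => hω k),
      integral_toReal (by fun_prop) (ae_of_all _ fun ω => (mass_ne_top k _).lt_top),
      ← lintegral_indicator hs']
    refine congrArg ENNReal.toReal (lintegral_congr fun ω => ?_)
    by_cases hω : ω ∈ s <;> simp [hω]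
  have hindicator : Measurable[past Θ n] (s.indicator fun _ => (1 : ℝ≥0∞)) :=
    measurable_const.indicator hs
  rw [hsetIntegral, hsetIntegral, lintegral_mul_mass_succ_of_past hmean n hindicator]

theorem ae_tendsto_W (hmean : ∀ᵐ ξ ∂τ, ∀ n, m η n 1 ξ = 1) :
    ∀ᵐ ω ∂(annealed τ η), Tendsto (fun n => W η n ω) atTop (𝓝 (Wlim η ω)) :=
  ((martingale_W hmean).submartingale.exists_ae_tendsto_of_bdd (R := 1)
    fun n => (eLpNorm_one_W hmean n).le).mono fun _ => tendsto_nhds_limUnder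

theorem convergesInLp_W_iff (hmean : ∀ᵐ ξ ∂τ, ∀ n, m η n 1 ξ = 1) {p : ℝ} (hp : 1 < p) :
    ConvergesInLp (annealed τ η) p (W η) (Wlim η) ↔ ⨆ n, annealedMoment τ η p n < ∞ := by
  have hp0 : 0 < p := by linarith
  have hsup : (⨆ n, eLpNorm (W η n) (ENNReal.ofReal p) (annealed τ η)) ^ p =
      ⨆ n, annealedMoment τ η p n := by
    simp_rw [← eLpNorm_W_rpow hmean hp0]
    exact (ENNReal.orderIsoRpow p hp0).map_iSup _
  rw [convergesInLp_iff_of_martingale hp (martingale_W hmean) (ae_tendsto_W hmean), ← hsup,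
    ENNReal.rpow_lt_top_iff_of_pos hp0]

end Martingale

end BRWRE

theorem mainTheorem2 {Θ : Type*} [MeasurableSpace Θ]
    (τ : Measure (ℕ → Θ)) [IsProbabilityMeasure τ]
    (η : Kernel Θ BRWRE.Mark) [IsMarkovKernel η]
    (h_indep : iIndepFun (fun (n : ℕ) (ξ : ℕ → Θ) => ξ n) τ)
    (h_ident : ∀ n : ℕ, IdentDistrib (fun ξ : ℕ → Θ => ξ n) (fun ξ : ℕ → Θ => ξ 0) τ τ)
    (h_mean : ∀ᵐ ξ ∂τ, BRWRE.m η 0 1 ξ = 1)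
    (h_nontrivial : BRWRE.annealed τ η {ω | BRWRE.W η 1 ω = 1} < 1)
    (p : ℝ) (hp : 1 < p) :
    (∀ᵐ ω ∂(BRWRE.annealed τ η),
      Tendsto (fun n => BRWRE.W η n ω) atTop (𝓝 (BRWRE.Wlim η ω))) ∧
    (BRWRE.ConvergesInLp (BRWRE.annealed τ η) p (BRWRE.W η) (BRWRE.Wlim η) ↔
      (∫⁻ ω, ENNReal.ofReal (BRWRE.W η 1 ω ^ p) ∂(BRWRE.annealed τ η) < ∞ ∧
        ∫⁻ ξ, BRWRE.m η 0 p ξ ∂τ < 1)) := by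
  have hmean : ∀ᵐ ξ ∂τ, ∀ n, BRWRE.m η n 1 ξ = 1 := BRWRE.ae_m_eq_one h_ident h_mean
  have hmass : ¬ ∀ᵐ ω ∂(BRWRE.annealed τ η), BRWRE.mass 1 ω.2 = 1 := by
    intro hone
    have hW : ∀ᵐ ω ∂(BRWRE.annealed τ η), BRWRE.W η 1 ω = 1 := by
      filter_upwards [hone, BRWRE.ae_W_eq hmean] with ω hω hWω
      rw [hWω, hω, ENNReal.toReal_one]
    exact h_nontrivial.ne ((measure_congr (eventuallyEq_univ.2 hW)).trans measure_univ)
  refine ⟨BRWRE.ae_tendsto_W hmean, ?_⟩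
  rw [BRWRE.convergesInLp_W_iff hmean hp, BRWRE.lintegral_W_rpow hmean (by linarith)]
  exact BRWRE.iSup_annealedMoment_lt_top_iff hp
    (BRWRE.measurePreserving_zero_shift h_indep h_ident) hmean hmass
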